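/- Let $D=\sum_{i\in I} n_i[t_i]$ be an effective divisor on $\mathbb P^1=\mathbb P^1_{\mathbb C}$, with $I=\{1,\dots,\nu\}$, distinct points $t_i$ (the point $\infty$ is allowed) and multiplicities $n_i\ge 1$ ($D$ need not be reduced). Let $E$ be a rank 2 vector bundle on $\mathbb P^1$, let $f_i$ be a generator of the maximal ideal of $\mathcal O_{\mathbb P^1,t_i}$, put $\mathcal O_{n_i[t_i]}=\mathcal O_{\mathbb P^1,t_i}/(f_i^{n_i})$ and $E|_{n_i[t_i]}=E\otimes\mathcal O_{n_i[t_i]}$. Definitions. A refined parabolic structure $\boldsymbol l$ on $E$ over $D$ is, for each $i\in I$, a filtration $E|_{n_i[t_i]}\supset l_{i,n_i}\supset\cdots\supset l_{i,1}\supset l_{i,0}=0$ by $\mathcal O_{n_i[t_i]}$-submodules with $\operatorname{length}(l_{i,k})=k$; the pair $(E,\boldsymbol l)$ is a refined parabolic bundle. For a line subbundle $L\subset E$ put $\lambda_{i,k}(L)=\operatorname{length}\big((l_{i,k}\cap L|_{n_i[t_i]})/(l_{i,k-1}\cap L|_{n_i[t_i]})\big)\in\{0,1\}$ and $\epsilon_{i,k}(L)=1-2\lambda_{i,k}(L)$.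 Weights are real numbers $\boldsymbol w=(w_{i,k})_{i\in I,\,1\le k\le n_i}$ with $0\le w_{i,n_i}\le\cdots\le w_{i,1}\le 1$. The bundle $(E,\boldsymbol l)$ is $\boldsymbol w$-stable if for every line subbundle $L\subset E$ $$\deg(E)-2\deg(L)+\sum_{i\in I}\sum_{k=1}^{n_i}w_{i,k}\,\epsilon_{i,k}(L)>0 .$$ It is decomposable if $E=L_1\oplus L_2$ for line subbundles $L_1,L_2$ such that $l_{i,k}=(l_{i,k}\cap L_1|_{n_i[t_i]})\oplus(l_{i,k}\cap L_2|_{n_i[t_i]})$ for all $i,k$, and undecomposable otherwise. Put $N_i(L)=\max_{1\le k'\le n_i}\sum_{k=1}^{k'}\epsilon_{i,k}(L)$ and $I^+_L=\{i\in I\mid N_i(L)>0\}$. The bundle $(E,\boldsymbol l)$ is tame if for every line subbundle $L\subset E$ with $\deg(E)\le 2\deg(L)$ the set $I^+_L$ is not empty and $-\deg(E)+2\deg(L)+1\le\sum_{i\in I^+_L}N_i(L)$. A parabolic structure on $E$ over $D$ is, for each $i\in I$, a free $\mathcal O_{n_i[t_i]}$-submodule $l_i\subset E|_{n_i[t_i]}$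 of length $n_i$. It induces the refined parabolic structure $l_{i,k}=f_i^{\,n_i-k}\,l_i$, through which the notions above apply to the parabolic bundle $(E,\{l_i\})$. The parabolic bundle is simple if the only endomorphisms of $E$ mapping every $l_i$ into itself are the scalars $c\cdot\mathrm{Id}_E$, $c\in\mathbb C$. Theorem. (1) A refined parabolic bundle $(E,\boldsymbol l)$ over $(\mathbb P^1,D)$ of rank 2 (and of any degree) is undecomposable and tame if and only if it is $\boldsymbol w$-stable for some weights $\boldsymbol w$. (2) For a parabolic bundle $(E,\{l_i\})$ over $(\mathbb P^1,D)$ of rank 2 (and of any degree), the following are equivalent: (a) it is simple; (b) the induced refined parabolic bundle is $\boldsymbol w$-stable for some weights $\boldsymbol w$; (c) the induced refined parabolic bundle is undecomposable and tame. -/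

import Mathlib

open Module

noncomputable section

namespace P1

/-! ### Vector bundles on the complex projective line

The projective line is covered by the charts `U 0 = Spec ℂ[x]` and `U 1 = Spec ℂ[x⁻¹]`, which meet
in `Spec ℂ[x, x⁻¹]`.  A vector bundle is given by its modules of sections over the two charts,
viewed inside the generic fibre, a vector space over the function field `ℂ(x)`. -/

/-- The function field `ℂ(x)` of the projective line. -/
abbrev K : Type := RatFunc ℂ

/-- The coordinate ring of the chart `j`: a polynomial ring `ℂ[y]`, with `y = x` for `j = 0` and
`y = x⁻¹` for `j = 1`. -/
def ChartRing (_ : Fin 2) : Type := Polynomial ℂ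

instance (j : Fin 2) : CommRing (ChartRing j) := inferInstanceAs (CommRing (Polynomial ℂ))

instance (j : Fin 2) : IsDomain (ChartRing j) := inferInstanceAs (IsDomain (Polynomial ℂ))

/-- The coordinate of the chart `j` as a rational function. -/
def coord : Fin 2 → K
  | 0 => RatFunc.X
  | 1 => RatFunc.X⁻¹

/-- The inclusion of the coordinate ring of the chart `j` into the function field. -/
def ChartRing.toK (j : Fin 2) : ChartRing j →+* K :=
  (Polynomial.aeval (coord j) : Polynomial ℂ →ₐ[ℂ] K).toRingHom

/-- Functions on the chart `j` act on every `ℂ(x)`-vector space as rational functions. -/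
instance (j : Fin 2) (V : Type*) [AddCommGroup V] [Module K V] : Module (ChartRing j) V :=
  Module.compHom V (ChartRing.toK j)

theorem ChartRing.smul_def (j : Fin 2) {V : Type*} [AddCommGroup V] [Module K V]
    (a : ChartRing j) (v : V) : a • v = ChartRing.toK j a • v := rfl

/-- An algebraic vector bundle on the projective line whose generic fibre is a subspace of the
`ℂ(x)`-vector space `V`: the (automatically torsion-free, hence locally free) finitely generated
modules of sections over the two charts, which agree on the intersection of the charts. -/
structure Bundle (V : Type*) [AddCommGroup V] [Module K V] where
  /-- The sections over the chart `j`. -/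
  sec : ∀ j : Fin 2, Submodule (ChartRing j) V
  fg : ∀ j, (sec j).FG
  /-- Both modules of sections have the same localization over the intersection of the charts. -/
  glue : ∀ v : V, (∃ m : ℕ, (RatFunc.X : K) ^ m • v ∈ sec 0) ↔
    (∃ m : ℕ, ((RatFunc.X : K)⁻¹) ^ m • v ∈ sec 1)

section Bundles

variable {V : Type*} [AddCommGroup V] [Module K V]

/-- The generic fibre. -/
def Bundle.genericFiber (F : Bundle V) : Submodule K V := Submodule.span K (F.sec 0 : Set V)

/-- `F` has degree `d`: the determinant of the transition matrix from a basis of sections over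
`U 0` to a basis of sections over `U 1` is a nonzero constant times `x ^ d`. -/
def Bundle.HasDegree (F : Bundle V) (d : ℤ) : Prop :=
  ∃ (r : ℕ) (b₀ b₁ : Basis (Fin r) K F.genericFiber),
    Submodule.span (ChartRing 0) (Set.range fun a => (b₀ a : V)) = F.sec 0 ∧
    Submodule.span (ChartRing 1) (Set.range fun a => (b₁ a : V)) = F.sec 1 ∧
    ∃ c : ℂ, c ≠ 0 ∧ b₀.det b₁ = RatFunc.C c * RatFunc.X ^ d

/-- The degree of a vector bundle. -/
def Bundle.degree (F : Bundle V) : ℤ := Classical.epsilon F.HasDegree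

end Bundles

/-- A vector bundle of rank two on the projective line, with generic fibre `V`. -/
structure RankTwoBundle (V : Type*) [AddCommGroup V] [Module K V] extends Bundle V where
  genericFiber_eq : toBundle.genericFiber = ⊤
  finrank_eq : finrank K V = 2

/-- A line subbundle `L` of `E`: a rank one subsheaf with torsion-free (so locally free)
quotient. -/
structure LineSubbundle {V : Type*} [AddCommGroup V] [Module K V] (E : RankTwoBundle V)
    extends Bundle V where
  le : ∀ j, sec j ≤ E.sec j
  rank_one : finrank K toBundle.genericFiber = 1
  saturated : ∀ j, ∀ a : ChartRing j, a ≠ 0 → ∀ s ∈ E.sec j, a • s ∈ sec j → s ∈ sec j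

theorem length_map_add_aux {R M : Type*} [CommRing R] [AddCommGroup M] [Module R M]
    (u : R) (N : Submodule R M) :
    Module.length R N =
      Module.length R (N ⊓ LinearMap.ker (LinearMap.lsmul R M u) : Submodule R M) +
      Module.length R (N.map (LinearMap.lsmul R M u)) := by
  refine Module.length_eq_add_of_exact (Submodule.inclusion inf_le_left)
    ((LinearMap.lsmul R M u).submoduleMap N) (Submodule.inclusion_injective _)
    (LinearMap.submoduleMap_surjective _ _) ?_
  intro x
  constructor
  · intro h
    have h2 : u • (x : M) = 0 := congrArg Subtype.val h
    exact ⟨⟨x, x.2, h2⟩, rfl⟩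
  · rintro ⟨y, rfl⟩
    exact Subtype.ext y.2.2

/-- In a free module `N` of length `n` over a ring with the divisibility properties of
`𝒪/(f ^ n)`, the submodule `f ^ a • N` has length `n - a`. -/
theorem length_smul_free_aux {R M : Type*} [CommRing R] [AddCommGroup M] [Module R M]
    (u : R) (n : ℕ) (hn : 0 < n) (hu : u ^ n = 0) (hdiv : ∀ k ≤ n, ∀ a : R, u ^ k * a = 0 → u ^ (n - k) ∣ a)
    (N : Submodule R M) [Module.Free R N] (hN : Module.length R N = n) (a : ℕ) (ha : a ≤ n) :
    Module.length R (N.map (LinearMap.lsmul R M (u ^ a))) = (n - a : ℕ) := by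
  have key : ∀ b < n, N.map (LinearMap.lsmul R M (u ^ b)) ⊓
      LinearMap.ker (LinearMap.lsmul R M u) = N.map (LinearMap.lsmul R M (u ^ (n - 1))) := by
    intro b hb
    apply le_antisymm
    · rintro x ⟨⟨y, hy, rfl⟩, hx⟩
      have hx' : u ^ (b + 1) • y = 0 := by
        have : u • u ^ b • y = 0 := hx
        rwa [smul_smul, ← pow_succ'] at this
      let e := Module.Free.chooseBasis R N
      have hdvd : ∀ j, u ^ (n - (b + 1)) ∣ e.repr ⟨y, hy⟩ j := by
        intro j
        apply hdiv (b + 1) (by omega)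
        have h0 : u ^ (b + 1) • (⟨y, hy⟩ : N) = 0 := Subtype.ext hx'
        have h1 := congrArg (fun z => e.repr z j) h0
        simpa only [map_smul, Finsupp.smul_apply, smul_eq_mul, map_zero, Finsupp.zero_apply] using h1
      choose c hc using hdvd
      have hy' : (⟨y, hy⟩ : N) = u ^ (n - (b + 1)) • ∑ j ∈ (e.repr ⟨y, hy⟩).support, c j • e j := by
        conv_lhs => rw [← e.linearCombination_repr ⟨y, hy⟩]
        rw [Finsupp.linearCombination_apply, Finsupp.sum, Finset.smul_sum]
        refine Finset.sum_congr rfl fun j _ => ?_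
        rw [smul_smul, ← hc j]
      refine ⟨_, (∑ j ∈ (e.repr ⟨y, hy⟩).support, c j • e j : N).2, ?_⟩
      have hy2 := congrArg Subtype.val hy'
      simp only [Submodule.coe_smul] at hy2
      simp only [LinearMap.lsmul_apply]
      conv_rhs => rw [hy2]
      rw [smul_smul, ← pow_add]
      congr 2
      omega
    · rintro x ⟨y, hy, rfl⟩
      refine ⟨⟨u ^ (n - 1 - b) • y, N.smul_mem _ hy, ?_⟩, ?_⟩
      · simp only [LinearMap.lsmul_apply, smul_smul, ← pow_add]
        congr 2
        omega
      · change u • u ^ (n - 1) • y = 0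
        rw [smul_smul, ← pow_succ', show n - 1 + 1 = n by omega, hu, zero_smul]
  have step : ∀ b < n, Module.length R (N.map (LinearMap.lsmul R M (u ^ b))) =
      Module.length R (N.map (LinearMap.lsmul R M (u ^ (n - 1)))) +
      Module.length R (N.map (LinearMap.lsmul R M (u ^ (b + 1)))) := by
    intro b hb
    have hmap : (N.map (LinearMap.lsmul R M (u ^ b))).map (LinearMap.lsmul R M u) =
        N.map (LinearMap.lsmul R M (u ^ (b + 1))) := by
      rw [← Submodule.map_comp]
      congr 1
      ext x
      simp [smul_smul, pow_succ, mul_comm]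
    rw [length_map_add_aux u, key b hb, hmap]
  generalize Module.length R (N.map (LinearMap.lsmul R M (u ^ (n - 1)))) = q at step
  have all : ∀ c ≤ n, Module.length R (N.map (LinearMap.lsmul R M (u ^ (n - c)))) = c * q := by
    intro c
    induction c with
    | zero =>
      intro _
      have : N.map (LinearMap.lsmul R M (u ^ n)) = ⊥ := by
        rw [hu, eq_bot_iff]
        rintro x ⟨y, _, rfl⟩
        simp
      rw [Nat.sub_zero, this]
      simp
    | succ c ih =>
      intro hc
      rw [step _ (by omega), show n - (c + 1) + 1 = n - c by omega, ih (by omega)]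
      push_cast
      ring
  have hq1 : q = 1 := by
    have h := all n le_rfl
    have h1 : N.map (LinearMap.lsmul R M (u ^ (n - n))) = N := by
      ext; simp
    rw [h1, hN] at h
    have hqt : q ≠ ⊤ := by
      rintro hqt
      rw [hqt, ENat.mul_top (by exact_mod_cast hn.ne')] at h
      exact ENat.natCast_ne_top _ h
    lift q to ℕ using hqt
    have h' : n = n * q := by exact_mod_cast h
    have : q = 1 := Nat.eq_of_mul_eq_mul_left hn (h'.symm.trans (mul_one n).symm)
    exact_mod_cast this
  have h := all (n - a) (by omega)
  rw [show n - (n - a) = a by omega, hq1, mul_one] at h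
  exact h

/-! ### Points, divisors and restriction to `n[t]` -/

/-- A chart containing the point `t` of the Riemann sphere: `U 0` for `t ≠ ∞`, `U 1` for `∞`. -/
def chartIdx : OnePoint ℂ → Fin 2
  | some _ => 0
  | none => 1

/-- A generator of the maximal ideal at `t`: `x - t` for `t ≠ ∞`, and `x⁻¹` for `t = ∞`. -/
def unif : ∀ t : OnePoint ℂ, ChartRing (chartIdx t)
  | some t => (Polynomial.X - Polynomial.C t : Polynomial ℂ)
  | none => (Polynomial.X : Polynomial ℂ)

/-- The ideal of the subscheme `n[t]` in the coordinate ring of the chart around `t`. -/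
abbrev thickIdeal (t : OnePoint ℂ) (n : ℕ) : Ideal (ChartRing (chartIdx t)) :=
  Ideal.span {unif t ^ n}

/-- The ring `𝒪_{n[t]}`. -/
def ThickRing (t : OnePoint ℂ) (n : ℕ) : Type := ChartRing (chartIdx t) ⧸ thickIdeal t n

instance (t : OnePoint ℂ) (n : ℕ) : CommRing (ThickRing t n) :=
  inferInstanceAs (CommRing (ChartRing (chartIdx t) ⧸ thickIdeal t n))

/-- The quotient map onto `𝒪_{n[t]}`. -/
def ThickRing.mk (t : OnePoint ℂ) (n : ℕ) : ChartRing (chartIdx t) →+* ThickRing t n :=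
  Ideal.Quotient.mk (thickIdeal t n)

/-- The class of the generator of the maximal ideal in `𝒪_{n[t]}`. -/
def thickUnif (t : OnePoint ℂ) (n : ℕ) : ThickRing t n := ThickRing.mk t n (unif t)

theorem unif_ne_zero (t : OnePoint ℂ) : unif t ≠ 0 := by
  cases t with
  | infty => exact Polynomial.X_ne_zero
  | coe t => exact Polynomial.X_sub_C_ne_zero t

theorem thickUnif_pow (t : OnePoint ℂ) (n : ℕ) : thickUnif t n ^ n = 0 := by
  rw [thickUnif, ← map_pow]
  exact Ideal.Quotient.eq_zero_iff_mem.2 (Ideal.mem_span_singleton_self _)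

theorem thickUnif_dvd (t : OnePoint ℂ) (n k : ℕ) (hk : k ≤ n) (a : ThickRing t n)
    (h : thickUnif t n ^ k * a = 0) : thickUnif t n ^ (n - k) ∣ a := by
  obtain ⟨a, rfl⟩ := Ideal.Quotient.mk_surjective a
  change ThickRing.mk t n (unif t) ^ k * ThickRing.mk t n a = 0 at h
  rw [← map_pow, ← map_mul] at h
  obtain ⟨c, hc⟩ := Ideal.mem_span_singleton.1 (Ideal.Quotient.eq_zero_iff_mem.1 h)
  have h1 : a = unif t ^ (n - k) * c := by
    apply mul_left_cancel₀ (pow_ne_zero k (unif_ne_zero t))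
    rw [hc, ← mul_assoc, ← pow_add, Nat.add_sub_cancel' hk]
  refine ⟨ThickRing.mk t n c, ?_⟩
  change ThickRing.mk t n a = _
  rw [h1, map_mul, map_pow, thickUnif]

/-- An effective divisor `D = ∑ i, mult i [pt i]` with distinct points and positive
multiplicities. -/
structure EffDivisor where
  /-- The number of points in the support. -/
  ν : ℕ
  pt : Fin ν → OnePoint ℂ
  pt_injective : Function.Injective pt
  mult : Fin ν → ℕ
  mult_pos : ∀ i, 0 < mult i

section Parabolic

variable {V : Type*} [AddCommGroup V] [Module K V]

/-- The restriction `E|_{n[t]}`, a module over `𝒪_{n[t]}`. -/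
def RankTwoBundle.Restr (E : RankTwoBundle V) (t : OnePoint ℂ) (n : ℕ) : Type _ :=
  E.sec (chartIdx t) ⧸
    (thickIdeal t n • (⊤ : Submodule (ChartRing (chartIdx t)) (E.sec (chartIdx t))))

instance (E : RankTwoBundle V) (t : OnePoint ℂ) (n : ℕ) : AddCommGroup (E.Restr t n) :=
  inferInstanceAs (AddCommGroup (E.sec (chartIdx t) ⧸
    (thickIdeal t n • (⊤ : Submodule (ChartRing (chartIdx t)) (E.sec (chartIdx t))))))

instance (E : RankTwoBundle V) (t : OnePoint ℂ) (n : ℕ) :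
    Module (ThickRing t n) (E.Restr t n) :=
  inferInstanceAs (Module (ChartRing (chartIdx t) ⧸ thickIdeal t n) (E.sec (chartIdx t) ⧸
    (thickIdeal t n • (⊤ : Submodule (ChartRing (chartIdx t)) (E.sec (chartIdx t))))))

/-- Restriction of sections. -/
def RankTwoBundle.res (E : RankTwoBundle V) (t : OnePoint ℂ) (n : ℕ) :
    E.sec (chartIdx t) →+ E.Restr t n :=
  (Submodule.mkQ (thickIdeal t n •
    (⊤ : Submodule (ChartRing (chartIdx t)) (E.sec (chartIdx t))))).toAddMonoidHom

theorem RankTwoBundle.res_smul (E : RankTwoBundle V) (t : OnePoint ℂ) (n : ℕ)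
    (a : ChartRing (chartIdx t)) (s : E.sec (chartIdx t)) :
    E.res t n (a • s) = ThickRing.mk t n a • E.res t n s := rfl

/-- `L|_{n[t]}` as a submodule of `E|_{n[t]}`. -/
def LineSubbundle.restr {E : RankTwoBundle V} (L : LineSubbundle E) (t : OnePoint ℂ) (n : ℕ) :
    Submodule (ThickRing t n) (E.Restr t n) :=
  Submodule.span _ (E.res t n '' {s | (s : V) ∈ L.sec (chartIdx t)})

/-- A refined parabolic structure on `E` over `D`: at each `t_i` a filtration
`0 = l_{i,0} ⊆ l_{i,1} ⊆ ⋯ ⊆ l_{i,n_i} ⊆ E|_{n_i[t_i]}` by `𝒪_{n_i[t_i]}`-modules with `l_{i,k}` of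
length `k`. -/
structure RefinedParabolic (D : EffDivisor) (E : RankTwoBundle V) where
  l : ∀ i, Fin (D.mult i + 1) →
    Submodule (ThickRing (D.pt i) (D.mult i)) (E.Restr (D.pt i) (D.mult i))
  mono : ∀ i, Monotone (l i)
  length_eq : ∀ i k, Module.length (ThickRing (D.pt i) (D.mult i)) (l i k) = (k : ℕ)

/-- A parabolic structure on `E` over `D`: at each `t_i` a free `𝒪_{n_i[t_i]}`-submodule of
`E|_{n_i[t_i]}` of length `n_i`. -/
structure Parabolic (D : EffDivisor) (E : RankTwoBundle V) where
  l : ∀ i, Submodule (ThickRing (D.pt i) (D.mult i)) (E.Restr (D.pt i) (D.mult i))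
  free : ∀ i, Module.Free (ThickRing (D.pt i) (D.mult i)) (l i)
  length_eq : ∀ i, Module.length (ThickRing (D.pt i) (D.mult i)) (l i) = D.mult i

/-- Weights `1 ≥ w_{i,1} ≥ ⋯ ≥ w_{i,n_i} ≥ 0`; here `w i k` stands for `w_{i,k+1}`. -/
structure Weights (D : EffDivisor) where
  w : ∀ i, Fin (D.mult i) → ℝ
  nonneg : ∀ i k, 0 ≤ w i k
  le_one : ∀ i k, w i k ≤ 1
  anti : ∀ i, Antitone (w i)

namespace RefinedParabolic

variable {D : EffDivisor} {E : RankTwoBundle V} (P : RefinedParabolic D E)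

/-- The length of `(l_{i,k+1} ∩ L|_{n_i[t_i]}) / (l_{i,k} ∩ L|_{n_i[t_i]})`. -/
def jump (L : LineSubbundle E) (i : Fin D.ν) (k : Fin (D.mult i)) : ℕ :=
  (Module.length (ThickRing (D.pt i) (D.mult i))
    (↥(P.l i k.succ ⊓ L.restr (D.pt i) (D.mult i)) ⧸
      (P.l i k.castSucc ⊓ L.restr (D.pt i) (D.mult i)).submoduleOf
        (P.l i k.succ ⊓ L.restr (D.pt i) (D.mult i)))).toNat

/-- The stability index of `L` with respect to the weights `w`. -/
def stab (w : Weights D) (L : LineSubbundle E) : ℝ :=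
  (E.degree : ℝ) - 2 * (L.degree : ℝ) +
    ∑ i, ∑ k, w.w i k * (1 - 2 * (P.jump L i k : ℝ))

/-- `w`-stability. -/
def Stable (w : Weights D) : Prop := ∀ L : LineSubbundle E, 0 < P.stab w L

/-- `E = L₁ ⊕ L₂` for line subbundles such that each `l_{i,k}` is the direct sum of its
intersections with `L₁|_{n_i[t_i]}` and `L₂|_{n_i[t_i]}`. -/
def Decomposable : Prop :=
  ∃ L₁ L₂ : LineSubbundle E,
    (∀ j, Disjoint (L₁.sec j) (L₂.sec j) ∧ L₁.sec j ⊔ L₂.sec j = E.sec j) ∧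
    ∀ i k,
      Disjoint (P.l i k ⊓ L₁.restr (D.pt i) (D.mult i))
        (P.l i k ⊓ L₂.restr (D.pt i) (D.mult i)) ∧
      P.l i k = (P.l i k ⊓ L₁.restr (D.pt i) (D.mult i)) ⊔
        (P.l i k ⊓ L₂.restr (D.pt i) (D.mult i))

/-- Not decomposable. -/
def Undecomposable : Prop := ¬ P.Decomposable

/-- The sign `ε_{i,k+1}(L)`. -/
def eps (L : LineSubbundle E) (i : Fin D.ν) (k : Fin (D.mult i)) : ℤ :=
  if P.jump L i k = 0 then 1 else -1

/-- `N_i(L)`, the maximum of the partial sums `ε_{i,1}(L) + ⋯ + ε_{i,k'}(L)`, `1 ≤ k' ≤ n_i`. -/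
def N (L : LineSubbundle E) (i : Fin D.ν) : ℤ :=
  Finset.univ.sup' ⟨⟨0, D.mult_pos i⟩, Finset.mem_univ _⟩
    fun k' : Fin (D.mult i) => ∑ k ∈ Finset.Iic k', P.eps L i k

/-- The set `I⁺_L` of the `i` with `N_i(L) > 0`. -/
def Iplus (L : LineSubbundle E) : Finset (Fin D.ν) := Finset.univ.filter fun i => 0 < P.N L i

/-- Tameness. -/
def Tame : Prop :=
  ∀ L : LineSubbundle E, E.degree ≤ 2 * L.degree →
    (P.Iplus L).Nonempty ∧ -E.degree + 2 * L.degree + 1 ≤ ∑ i ∈ P.Iplus L, P.N L i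

end RefinedParabolic

namespace Parabolic

variable {D : EffDivisor} {E : RankTwoBundle V} (P : Parabolic D E)

/-- `φ` is an endomorphism of the parabolic bundle: it maps sections of `E` to sections of `E`, and
the induced endomorphism of `E|_{n_i[t_i]}` maps `l_i` to itself. -/
def IsEndo (φ : V →ₗ[K] V) : Prop :=
  ∃ h : ∀ j, ∀ s ∈ E.sec j, φ s ∈ E.sec j,
    ∀ i, ∀ s : E.sec (chartIdx (D.pt i)), E.res (D.pt i) (D.mult i) s ∈ P.l i →
      E.res (D.pt i) (D.mult i) ⟨φ s, h _ s s.2⟩ ∈ P.l i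

/-- The corresponding refined parabolic structure, `l_{i,k} = f_i ^ (n_i - k) • l_i` with `f_i` a
generator of the maximal ideal at `t_i`. -/
def toRefined : RefinedParabolic D E where
  l i k := (P.l i).map (LinearMap.lsmul _ _
    (thickUnif (D.pt i) (D.mult i) ^ (D.mult i - (k : ℕ))))
  mono i k k' h := by
    rintro _ ⟨y, hy, rfl⟩
    refine ⟨thickUnif (D.pt i) (D.mult i) ^ ((k' : ℕ) - (k : ℕ)) • y,
      (P.l i).smul_mem _ hy, ?_⟩
    have h1 : (k : ℕ) ≤ k' := h
    simp only [LinearMap.lsmul_apply, smul_smul, ← pow_add]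
    congr 2
    omega
  length_eq i k := by
    have := P.free i
    have hk : (k : ℕ) ≤ D.mult i := Nat.lt_succ_iff.1 k.2
    rw [length_smul_free_aux _ _ (D.mult_pos i) (thickUnif_pow _ _)
      (fun k hk a => thickUnif_dvd _ _ k hk a) (P.l i) (P.length_eq i) _ (Nat.sub_le _ _)]
    congr 1
    omega

/-- Simplicity: the only endomorphisms are the scalars in `ℂ`. -/
def Simple : Prop := ∀ φ : V →ₗ[K] V, P.IsEndo φ → ∃ c : ℂ, ∀ v, φ v = RatFunc.C c • v

end Parabolic

end Parabolic

end P1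

end

/-! Everything rests on comparing two distinct line subbundles `L` and `L'`. The composite L' → E →
E/L is a nonzero section of 𝒪(e), e = deg E − deg L − deg L', so its orders e_i at the t_i add up to
at most e (`exists_wedge`, `sum_ordAt_le`). Locally this gives length(l_{i,k} ∩ L) + length(l_{i,k}
∩ L') ≤ k + e_i. Weights decrease in k, so summation by parts turns these bounds into stab_w(L) +
stab_w(L') ≥ 0 for every w (`stab_add_nonneg`). For the weights `Weights.interior` the sum is a
multiple of 1/M with M = 1 + deg D, and it vanishes only if E = L ⊕ L' compatibly with the
filtrations. Hence it is at least 1/M on an undecomposable bundle (`interior_le_stab_add`).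

Consequently at most one L₀ violates stability for the interior weights. The maximum of stab_w(L)
over the weight polytope is deg E − 2 deg L plus the sum of the positive N_i(L), attained at a
vertex, so tameness says that each L separately has weights making its index positive. On the
segment from the interior weights to such weights for L₀ there is a point where the index of L₀ is
already positive while the gap 1/M keeps all others positive (`exists_stable`). Conversely,
positivity of the maximum is tameness, and the two summands of a decomposition have opposite
indices.

For parabolic bundles, an endomorphism has constant characteristic polynomial, hence an eigenvalue
in ℂ. If it is not scalar, subtracting the eigenvalue leaves a nonzero singular map, whose kernel
and saturated image have indices with nonpositive sum, against stability (`exists_stab_add_nonpos`).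
If the bundle is decomposable, a projection is a nonscalar endomorphism. If tameness fails at `L`,
there is a section of Hom(E/L, L) vanishing to order max(N_i(L), 0) at t_i, and E → E/L → L → E is a
nonscalar endomorphism (`smul_uRes_mem`). -/

namespace P1

/-! ### The coordinate rings of the charts -/

instance (j : Fin 2) : IsPrincipalIdealRing (ChartRing j) :=
  inferInstanceAs (IsPrincipalIdealRing (Polynomial ℂ))

noncomputable instance (j : Fin 2) : Algebra (ChartRing j) K where
  algebraMap := ChartRing.toK j
  commutes' _ _ := mul_comm _ _
  smul_def' _ _ := rfl

instance (j : Fin 2) (V : Type*) [AddCommGroup V] [Module K V] :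
    IsScalarTower (ChartRing j) K V where
  smul_assoc a k v := mul_smul (ChartRing.toK j a) k v

theorem ratX_ne_zero : (RatFunc.X : K) ≠ 0 := RatFunc.X_ne_zero

theorem toK_zero_apply (p : Polynomial ℂ) :
    ChartRing.toK 0 p = algebraMap (Polynomial ℂ) K p := by
  change Polynomial.aeval (RatFunc.X : K) p = _
  rw [← RatFunc.algebraMap_X, Polynomial.aeval_algebraMap_apply, Polynomial.aeval_X_left_apply]

theorem toK_C (j : Fin 2) (c : ℂ) :
    ChartRing.toK j (Polynomial.C c : Polynomial ℂ) = RatFunc.C c := by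
  change Polynomial.aeval (coord j) (Polynomial.C c) = _
  rw [Polynomial.aeval_C]
  rfl

/-- The constant functions on the chart `j`. -/
noncomputable def ChartRing.C (j : Fin 2) (c : ℂ) : ChartRing j :=
  (Polynomial.C c : Polynomial ℂ)

theorem ChartRing.toK_C (j : Fin 2) (c : ℂ) :
    ChartRing.toK j (ChartRing.C j c) = RatFunc.C c := P1.toK_C j c

/-- Reversing coefficients realizes x ↔ x⁻¹. Leaving `N` free lets `p` be read as a section of 𝒪(N),
and lets two polynomials be reflected with the same factor. -/
theorem toK_one_reflect (p : Polynomial ℂ) (N : ℕ) (h : p.natDegree ≤ N) :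
    ChartRing.toK 1 (p.reflect N : Polynomial ℂ) * RatFunc.X ^ N = ChartRing.toK 0 p := by
  let _ : Invertible (RatFunc.X : K) := invertibleOfNonzero ratX_ne_zero
  exact Polynomial.eval₂_reflect_mul_pow (algebraMap ℂ K) (RatFunc.X : K) N p h

theorem toK_zero_reverse (p : Polynomial ℂ) :
    ChartRing.toK 0 (p.reverse : Polynomial ℂ) =
      RatFunc.X ^ p.natDegree * ChartRing.toK 1 p := by
  let _ : Invertible ((RatFunc.X : K)⁻¹) := invertibleOfNonzero (inv_ne_zero ratX_ne_zero)
  have h := Polynomial.eval₂_reverse_mul_pow (algebraMap ℂ K) ((RatFunc.X : K)⁻¹) p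
  have h2 : (⅟((RatFunc.X : K)⁻¹)) = RatFunc.X := by simp
  rw [h2] at h
  change ChartRing.toK 0 (p.reverse : Polynomial ℂ) * _ = ChartRing.toK 1 p at h
  rw [← h, mul_left_comm, ← mul_pow, mul_inv_cancel₀ ratX_ne_zero, one_pow, mul_one]

theorem toK_injective (j : Fin 2) : Function.Injective (ChartRing.toK j) := by
  have h0 : Function.Injective (ChartRing.toK 0) := by
    intro a b h
    exact RatFunc.algebraMap_injective ℂ
      ((toK_zero_apply a).symm.trans (h.trans (toK_zero_apply b)))
  fin_cases j
  · exact h0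
  · rw [injective_iff_map_eq_zero]
    intro a h
    have h1 := toK_zero_reverse a
    have h' : ChartRing.toK 1 a = 0 := h
    rw [h', mul_zero, ← map_zero (ChartRing.toK 0)] at h1
    exact Polynomial.reverse_eq_zero.1 (h0 h1)

theorem toK_ne_zero {j : Fin 2} {a : ChartRing j} (h : a ≠ 0) : ChartRing.toK j a ≠ 0 :=
  fun h' => h (toK_injective j (h'.trans (map_zero _).symm))

theorem exists_mul_toK_eq (j : Fin 2) (k : K) :
    ∃ a b : ChartRing j, b ≠ 0 ∧ ChartRing.toK j b * k = ChartRing.toK j a := by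
  have h0 : ∃ a b : Polynomial ℂ, b ≠ 0 ∧ ChartRing.toK 0 b * k = ChartRing.toK 0 a := by
    refine ⟨k.num, k.denom, k.denom_ne_zero, ?_⟩
    rw [toK_zero_apply, toK_zero_apply]
    conv_lhs => rw [← RatFunc.num_div_denom k]
    rw [RatFunc.num_div_denom, mul_comm, ← RatFunc.num_div_denom k]
    have : algebraMap (Polynomial ℂ) K k.denom ≠ 0 := RatFunc.algebraMap_ne_zero k.denom_ne_zero
    rw [RatFunc.num_div_denom]
    rw [← eq_div_iff this, RatFunc.num_div_denom]
  obtain ⟨a, b, hb, h⟩ := h0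
  fin_cases j
  · exact ⟨a, b, hb, h⟩
  -- Numerator and denominator are reflected in the same degree, so that the powers of x cancel.
  · refine ⟨a.reflect (max a.natDegree b.natDegree), b.reflect (max a.natDegree b.natDegree),
      fun h => hb (Polynomial.reflect_eq_zero_iff.1 h), ?_⟩
    rw [← toK_one_reflect a _ (le_max_left a.natDegree b.natDegree),
      ← toK_one_reflect b _ (le_max_right a.natDegree b.natDegree), mul_right_comm] at h
    exact mul_right_cancel₀ (pow_ne_zero _ ratX_ne_zero) h

instance (j : Fin 2) : IsFractionRing (ChartRing j) K where
  map_units y := (toK_ne_zero (nonZeroDivisors.ne_zero y.2)).isUnit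
  surj k := by
    obtain ⟨a, b, hb, h⟩ := exists_mul_toK_eq j k
    exact ⟨(a, ⟨b, mem_nonZeroDivisors_of_ne_zero hb⟩), by rw [mul_comm]; exact h⟩
  exists_of_eq h := ⟨1, by rw [toK_injective j h]⟩

theorem intDegree_toK_zero (p : Polynomial ℂ) :
    (ChartRing.toK 0 p).intDegree = p.natDegree := by
  rw [toK_zero_apply, RatFunc.intDegree_polynomial]

theorem intDegree_X_pow (n : ℕ) : (RatFunc.X ^ n : K).intDegree = n := by
  have h : (RatFunc.X ^ n : K) = algebraMap (Polynomial ℂ) K (Polynomial.X ^ n) := by simp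
  rw [h, RatFunc.intDegree_polynomial, Polynomial.natDegree_X_pow]

theorem intDegree_X_zpow (n : ℤ) : (RatFunc.X ^ n : K).intDegree = n := by
  obtain ⟨m, rfl | rfl⟩ := n.eq_nat_or_neg
  · rw [zpow_natCast, intDegree_X_pow]
  · rw [zpow_neg, zpow_natCast, RatFunc.intDegree_inv, intDegree_X_pow]

/-- `intDegree` is the pole order at ∞, and there x⁻¹ is the local coordinate. -/
theorem intDegree_toK_one (p : Polynomial ℂ) (hp : p ≠ 0) :
    (ChartRing.toK 1 p).intDegree = -(p.natTrailingDegree : ℤ) := by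
  have h := congrArg RatFunc.intDegree (toK_zero_reverse p)
  have hp' : ChartRing.toK 1 p ≠ 0 := toK_ne_zero (j := 1) hp
  rw [intDegree_toK_zero, RatFunc.intDegree_mul (pow_ne_zero _ ratX_ne_zero) hp',
    intDegree_X_pow] at h
  have h2 := Polynomial.natDegree_eq_reverse_natDegree_add_natTrailingDegree p
  omega

/-- Functions on both charts which differ by `x ^ (-e)`: a section of `𝒪(e)`. -/
theorem natDegree_add_natTrailingDegree_eq {g₀ g₁ : Polynomial ℂ} (h₀ : g₀ ≠ 0) {e : ℤ}
    (h : ChartRing.toK 1 g₁ = RatFunc.X ^ (-e) * ChartRing.toK 0 g₀) :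
    (g₀.natDegree + g₁.natTrailingDegree : ℤ) = e := by
  have h0 : ChartRing.toK 0 g₀ ≠ 0 := toK_ne_zero (j := 0) h₀
  have hx : (RatFunc.X : K) ^ (-e) ≠ 0 := zpow_ne_zero _ ratX_ne_zero
  have h1 : g₁ ≠ 0 := by
    rintro rfl
    exact mul_ne_zero hx h0 (h.symm.trans (map_zero _))
  have h2 := congrArg RatFunc.intDegree h
  rw [intDegree_toK_one _ h1, RatFunc.intDegree_mul hx h0, intDegree_X_zpow,
    intDegree_toK_zero] at h2
  omega

/-- A global function on the projective line is constant: degree plus order at ∞ is zero, so both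
vanish. -/
theorem exists_C_of_section_zero {g₀ g₁ : Polynomial ℂ}
    (h : ChartRing.toK 1 g₁ = ChartRing.toK 0 g₀) :
    ∃ c : ℂ, g₀ = Polynomial.C c ∧ g₁ = Polynomial.C c := by
  have hd : g₀.natDegree = 0 := by
    by_cases h₀ : g₀ = 0
    · simp [h₀]
    · have := natDegree_add_natTrailingDegree_eq (e := 0) h₀ (by simpa using h)
      omega
  refine ⟨g₀.coeff 0, Polynomial.eq_C_of_natDegree_eq_zero hd, ?_⟩
  rw [Polynomial.eq_C_of_natDegree_eq_zero hd, toK_C, ← toK_C 1] at h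
  exact toK_injective 1 h

/-- A rational function without zeros and poles on the intersection of the charts. -/
theorem eq_C_mul_X_zpow {k : K} {s₀ s₁ : Polynomial ℂ} {m m' : ℕ}
    (h₀ : ChartRing.toK 0 s₀ = RatFunc.X ^ m' * k)
    (h₁ : ChartRing.toK 1 s₁ * k = RatFunc.X⁻¹ ^ m) :
    ∃ (c : ℂ) (d : ℤ), c ≠ 0 ∧ k = RatFunc.C c * RatFunc.X ^ d := by
  have hX := ratX_ne_zero
  have key : algebraMap (Polynomial ℂ) K (s₀ * s₁.reverse * Polynomial.X ^ m) =
      algebraMap (Polynomial ℂ) K (Polynomial.X ^ (m' + s₁.natDegree)) := by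
    rw [map_mul, map_mul, ← toK_zero_apply, ← toK_zero_apply, h₀, toK_zero_reverse]
    simp only [map_pow, RatFunc.algebraMap_X]
    calc _ = RatFunc.X ^ (m' + s₁.natDegree) * (ChartRing.toK 1 s₁ * k) * RatFunc.X ^ m := by ring
      _ = _ := by rw [h₁, mul_assoc, ← mul_pow, inv_mul_cancel₀ hX, one_pow, mul_one]
  have key' := RatFunc.algebraMap_injective ℂ key
  -- A divisor of a power of the prime x is a constant times a power of x, which determines `k`.
  have hdvd : s₀ ∣ Polynomial.X ^ (m' + s₁.natDegree) := ⟨_, by rw [← key', mul_assoc]⟩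
  obtain ⟨i, -, hi⟩ := (dvd_prime_pow Polynomial.prime_X _).1 hdvd
  obtain ⟨u, hu⟩ := hi.symm
  obtain ⟨c, hc, hcu⟩ := Polynomial.isUnit_iff.1 u.isUnit
  refine ⟨c, i - m', hc.ne_zero, ?_⟩
  rw [← hu, ← hcu, toK_zero_apply] at h₀
  simp only [map_mul, map_pow, RatFunc.algebraMap_X, RatFunc.algebraMap_C] at h₀
  rw [zpow_sub₀ hX, zpow_natCast, zpow_natCast]
  field_simp
  rw [mul_comm k, ← h₀, mul_comm]

variable {V : Type*} [AddCommGroup V] [Module K V]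

/-! ### Generators over the charts and the degree -/

/-- A finitely generated submodule of the fraction field is a fractional ideal, and the chart ring
is a principal ideal domain. -/
theorem exists_generator_of_fg {j : Fin 2} (I : Submodule (ChartRing j) K) (hI : I.FG) :
    ∃ x : K, I = Submodule.span (ChartRing j) {x} := by
  have h := FractionalIdeal.isPrincipal (R := ChartRing j) (K := K)
    ⟨I, FractionalIdeal.isFractional_of_fg hI⟩
  exact h.principal

/-- A nonzero vector of the generic line identifies that line with the function field and `N` with a
fractional ideal. -/
theorem exists_generator_of_finrank_eq_one {j : Fin 2} (N : Submodule (ChartRing j) V)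
    (hN : N.FG) (h1 : finrank K (Submodule.span K (N : Set V)) = 1) :
    ∃ u : V, u ≠ 0 ∧ N = Submodule.span (ChartRing j) {u} := by
  obtain ⟨⟨w, hw⟩, hw0, hspan⟩ := finrank_eq_one_iff'.1 h1
  have hw0' : w ≠ 0 := fun h => hw0 (Subtype.ext h)
  let g : K →ₗ[ChartRing j] V := (LinearMap.toSpanSingleton K V w).restrictScalars (ChartRing j)
  have hg : Function.Injective g := fun a b hab => by
    exact smul_left_injective K hw0' hab
  have hmap : (N.comap g).map g = N := by
    rw [Submodule.map_comap_eq, inf_eq_right]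
    intro v hv
    obtain ⟨c, hc⟩ := hspan ⟨v, Submodule.subset_span hv⟩
    exact ⟨c, congrArg Subtype.val hc⟩
  obtain ⟨x, hx⟩ := exists_generator_of_fg (N.comap g)
    (Submodule.fg_of_fg_map_injective g hg (by rwa [hmap]))
  have hN' : N = Submodule.span (ChartRing j) {g x} := by
    rw [← hmap, hx, Submodule.map_span, Set.image_singleton]
  refine ⟨g x, fun h0 => ?_, hN'⟩
  rw [h0, Submodule.span_zero_singleton] at hN'
  have hbot : Submodule.span K (N : Set V) = ⊥ := by
    rw [hN', Submodule.bot_coe, Submodule.span_zero_singleton]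
  rw [hbot, finrank_bot] at h1
  exact zero_ne_one h1

theorem span_chart_span (j : Fin 2) (s : Set V) :
    Submodule.span K (Submodule.span (ChartRing j) s : Set V) = Submodule.span K s :=
  Submodule.span_span_of_tower (ChartRing j) K s

theorem Bundle.exists_smul_mem_one (F : Bundle V) {v : V} (hv : v ∈ F.sec 0) :
    ∃ m : ℕ, ((RatFunc.X : K)⁻¹) ^ m • v ∈ F.sec 1 :=
  (F.glue v).1 ⟨0, by simpa using hv⟩

theorem Bundle.exists_smul_mem_zero (F : Bundle V) {v : V} (hv : v ∈ F.sec 1) :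
    ∃ m : ℕ, (RatFunc.X : K) ^ m • v ∈ F.sec 0 :=
  (F.glue v).2 ⟨0, by simpa using hv⟩

theorem Bundle.span_sec (F : Bundle V) (j : Fin 2) :
    Submodule.span K (F.sec j : Set V) = F.genericFiber := by
  have key : ∀ (S : Submodule K V) (k : K) (m : ℕ) (v : V), k ≠ 0 → k ^ m • v ∈ S → v ∈ S :=
    fun S k m v hk h => (S.smul_mem_iff (pow_ne_zero m hk)).1 h
  fin_cases j
  · rfl
  · apply le_antisymm
    · refine Submodule.span_le.2 fun v hv => ?_
      obtain ⟨m, hm⟩ := F.exists_smul_mem_zero hv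
      exact key _ _ m v ratX_ne_zero (Submodule.subset_span hm)
    · refine Submodule.span_le.2 fun v hv => ?_
      obtain ⟨m, hm⟩ := F.exists_smul_mem_one hv
      exact key _ _ m v (inv_ne_zero ratX_ne_zero) (Submodule.subset_span hm)

theorem exists_det_eq_toK {j : Fin 2} {W : Submodule K V} {r : ℕ} (b b' : Basis (Fin r) K W)
    (h : ∀ a, (b' a : V) ∈ Submodule.span (ChartRing j) (Set.range fun a => (b a : V))) :
    ∃ p : ChartRing j, b.det b' = ChartRing.toK j p := by
  choose A hA using fun a => (Submodule.mem_span_range_iff_exists_fun (ChartRing j)).1 (h a)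
  have hmat : b.toMatrix b' = (Matrix.of fun i a => A a i).map (ChartRing.toK j) := by
    ext i a
    have hb : b' a = ∑ i, ChartRing.toK j (A a i) • b i := by
      apply Subtype.ext
      rw [← hA a]
      push_cast
      rfl
    rw [Basis.toMatrix_apply, hb, Basis.repr_sum_self]
    rfl
  exact ⟨(Matrix.of fun i a => A a i).det, by
    rw [Basis.det_apply, hmat, RingHom.map_det, RingHom.mapMatrix_apply]⟩

/-- The determinants of the two base changes are inverse polynomials, and the units of ℂ[y] are the
nonzero constants. -/
theorem exists_det_eq_C {j : Fin 2} {W : Submodule K V} {r : ℕ} (b b' : Basis (Fin r) K W)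
    (h : Submodule.span (ChartRing j) (Set.range fun a => (b a : V)) =
      Submodule.span (ChartRing j) (Set.range fun a => (b' a : V))) :
    ∃ c : ℂ, c ≠ 0 ∧ b.det b' = RatFunc.C c := by
  obtain ⟨p, hp⟩ := exists_det_eq_toK b b' fun a => by rw [h]; exact Submodule.subset_span ⟨a, rfl⟩
  obtain ⟨q, hq⟩ := exists_det_eq_toK b' b fun a => by rw [← h]; exact Submodule.subset_span ⟨a, rfl⟩
  have hpq : p * q = 1 := by
    apply toK_injective j
    rw [map_mul, ← hp, ← hq, map_one, Basis.det_apply, Basis.det_apply, ← Matrix.det_mul,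
      Basis.toMatrix_mul_toMatrix, Basis.toMatrix_self, Matrix.det_one]
  obtain ⟨c, hc, hcp⟩ := Polynomial.isUnit_iff.1 (IsUnit.of_mul_eq_one (M := Polynomial ℂ) q hpq)
  refine ⟨c, hc.ne_zero, ?_⟩
  rw [hp, ← toK_C j, hcp]

theorem intDegree_C_mul_X_zpow {c : ℂ} (hc : c ≠ 0) (d : ℤ) :
    (RatFunc.C c * RatFunc.X ^ d : K).intDegree = d := by
  rw [RatFunc.intDegree_mul (by simpa using hc) (zpow_ne_zero _ ratX_ne_zero),
    RatFunc.intDegree_C, intDegree_X_zpow, zero_add]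

/-- Changing the two frames multiplies the transition determinant by constants only. Uniqueness is
what makes the choice in `Bundle.degree` harmless. -/
theorem Bundle.HasDegree.unique {F : Bundle V} {d d' : ℤ} (h : F.HasDegree d)
    (h' : F.HasDegree d') : d = d' := by
  obtain ⟨r, b₀, b₁, h₀, h₁, c, hc, hd⟩ := h
  obtain ⟨r', b₀', b₁', h₀', h₁', c', hc', hd'⟩ := h'
  obtain rfl : r = r' := by
    simpa using (finrank_eq_card_basis b₀).symm.trans (finrank_eq_card_basis b₀')
  obtain ⟨e, he, hbe⟩ := exists_det_eq_C b₀ b₀' (h₀.trans h₀'.symm)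
  obtain ⟨e', he', hbe'⟩ := exists_det_eq_C b₁' b₁ (h₁'.trans h₁.symm)
  have hprod : b₀.det b₁ = b₀.det b₀' * b₀'.det b₁' * b₁'.det b₁ := by
    simp only [Basis.det_apply, ← Matrix.det_mul, Basis.toMatrix_mul_toMatrix]
  rw [hd, hd', hbe, hbe'] at hprod
  have h2 : (RatFunc.C c * RatFunc.X ^ d : K) =
      RatFunc.C (e * c' * e') * RatFunc.X ^ d' := by
    rw [hprod, map_mul, map_mul]; ring
  rw [← intDegree_C_mul_X_zpow hc d, h2,
    intDegree_C_mul_X_zpow (mul_ne_zero (mul_ne_zero he hc') he')]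

theorem Bundle.degree_eq_of_hasDegree {F : Bundle V} {d : ℤ} (h : F.HasDegree d) :
    F.degree = d :=
  (Classical.epsilon_spec (p := F.HasDegree) ⟨d, h⟩).unique h

/-- The degree computed from frames over the charts and their transition matrix. -/
theorem Bundle.degree_eq (F : Bundle V) {r : ℕ} {w₀ w₁ : Fin r → V}
    (hw₀ : LinearIndependent K w₀) (hw₁ : LinearIndependent K w₁)
    (h₀ : Submodule.span (ChartRing 0) (Set.range w₀) = F.sec 0)
    (h₁ : Submodule.span (ChartRing 1) (Set.range w₁) = F.sec 1)
    (A : Matrix (Fin r) (Fin r) K) (hA : ∀ a, w₁ a = ∑ i, A i a • w₀ i)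
    {c : ℂ} (hc : c ≠ 0) {d : ℤ} (hdet : A.det = RatFunc.C c * RatFunc.X ^ d) :
    F.degree = d := by
  apply Bundle.degree_eq_of_hasDegree
  have hs₀ : F.genericFiber = Submodule.span K (Set.range w₀) := by
    rw [← F.span_sec 0, ← h₀, span_chart_span]
  have hs₁ : F.genericFiber = Submodule.span K (Set.range w₁) := by
    rw [← F.span_sec 1, ← h₁, span_chart_span]
  let b₀ : Basis (Fin r) K F.genericFiber :=
    (Basis.span hw₀).map (LinearEquiv.ofEq _ _ hs₀.symm)
  let b₁ : Basis (Fin r) K F.genericFiber :=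
    (Basis.span hw₁).map (LinearEquiv.ofEq _ _ hs₁.symm)
  have hb₀ : ∀ a, (b₀ a : V) = w₀ a := fun a => by simp [b₀, Basis.span_apply]
  have hb₁ : ∀ a, (b₁ a : V) = w₁ a := fun a => by simp [b₁, Basis.span_apply]
  refine ⟨r, b₀, b₁, by simpa only [hb₀] using h₀, by simpa only [hb₁] using h₁, c, hc, ?_⟩
  have hmat : b₀.toMatrix b₁ = A := by
    ext i a
    have : b₁ a = ∑ i, A i a • b₀ i := by
      apply Subtype.ext
      rw [hb₁, hA]
      simp [hb₀]
    rw [Basis.toMatrix_apply, this, Basis.repr_sum_self]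
  rw [Basis.det_apply, hmat, hdet]

/-! ### Line subbundles and adapted frames -/

theorem Bundle.exists_smul_mem_sec (F : Bundle V) {w : V} (hw : w ∈ F.genericFiber) :
    ∃ b : ChartRing 0, b ≠ 0 ∧ b • w ∈ F.sec 0 := by
  induction hw using Submodule.span_induction with
  | mem x hx => exact ⟨1, one_ne_zero, by rw [one_smul]; exact hx⟩
  | zero => exact ⟨1, one_ne_zero, by rw [smul_zero]; exact zero_mem _⟩
  | add x y _ _ hx hy =>
    obtain ⟨a, ha, hax⟩ := hx
    obtain ⟨b, hb, hby⟩ := hy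
    refine ⟨a * b, mul_ne_zero ha hb, ?_⟩
    rw [smul_add, mul_comm, mul_smul, mul_comm, mul_smul]
    exact add_mem ((F.sec 0).smul_mem _ hax) ((F.sec 0).smul_mem _ hby)
  | smul k x _ hx =>
    obtain ⟨a, ha, hax⟩ := hx
    obtain ⟨p, q, hq, hpq⟩ := exists_mul_toK_eq 0 k
    refine ⟨a * q, mul_ne_zero ha hq, ?_⟩
    have : (a * q) • k • x = p • a • x := by
      simp only [ChartRing.smul_def, smul_smul, map_mul]
      rw [mul_assoc, hpq, mul_comm]
    rw [this]
    exact (F.sec 0).smul_mem _ hax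

/-- The line subbundle with a given generic fibre. -/
noncomputable def RankTwoBundle.lineSubbundle (E : RankTwoBundle V) (W : Submodule K V)
    (hW : finrank K W = 1) : LineSubbundle E where
  sec j := E.sec j ⊓ W.restrictScalars (ChartRing j)
  fg j := (E.fg j).of_le inf_le_left
  glue v := by
    have h (k : K) (hk : k ≠ 0) (m : ℕ) : k ^ m • v ∈ W ↔ v ∈ W :=
      W.smul_mem_iff (pow_ne_zero m hk)
    simp only [Submodule.mem_inf, Submodule.restrictScalars_mem, h _ ratX_ne_zero,
      h _ (inv_ne_zero ratX_ne_zero), exists_and_right, E.glue v]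
  le j := inf_le_left
  rank_one := by
    refine (congrArg (fun S : Submodule K V => finrank K S) (le_antisymm ?_ ?_)).trans hW
    · exact Submodule.span_le.2 fun v hv => hv.2
    · intro w hw
      obtain ⟨b, hb, hbw⟩ := E.toBundle.exists_smul_mem_sec
        (w := w) (by rw [E.genericFiber_eq]; trivial)
      exact (Submodule.smul_mem_iff _ (toK_ne_zero hb)).1
        (Submodule.subset_span ⟨hbw, W.smul_mem _ hw⟩)
  saturated j a ha s hs has := ⟨hs, (W.smul_mem_iff (toK_ne_zero ha)).1 has.2⟩

namespace LineSubbundle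

variable {E : RankTwoBundle V}

theorem exists_generator (L : LineSubbundle E) (j : Fin 2) :
    ∃ u : V, u ≠ 0 ∧ L.sec j = Submodule.span (ChartRing j) {u} := by
  refine exists_generator_of_finrank_eq_one _ (L.fg j) ?_
  rw [L.span_sec]
  exact L.rank_one

/-- Saturation recovers a line subbundle from its generic fibre: a section of `E` lying in it
becomes a section of `L` after clearing a denominator. -/
theorem mem_sec_iff (L : LineSubbundle E) (j : Fin 2) (s : V) :
    s ∈ L.sec j ↔ s ∈ E.sec j ∧ s ∈ L.genericFiber := by
  refine ⟨fun h => ⟨L.le j h, ?_⟩, fun ⟨hE, hs⟩ => ?_⟩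
  · rw [← L.span_sec j]
    exact Submodule.subset_span h
  · obtain ⟨u, -, hu⟩ := L.exists_generator j
    rw [← L.span_sec j, hu, span_chart_span] at hs
    obtain ⟨k, rfl⟩ := Submodule.mem_span_singleton.1 hs
    obtain ⟨a, b, hb, hab⟩ := exists_mul_toK_eq j k
    refine L.saturated j b hb _ hE ?_
    rw [ChartRing.smul_def, smul_smul, hab, hu]
    exact Submodule.mem_span_singleton.2 ⟨a, rfl⟩

/-- E/L has rank one and embeds in the function field as a fractional ideal. Any lift `v` of a
generator of that ideal splits the projection. -/
theorem exists_complement (L : LineSubbundle E) (j : Fin 2) {u : V}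
    (hu : L.sec j = Submodule.span (ChartRing j) {u}) :
    ∃ v : V, v ∉ L.genericFiber ∧
      ∀ s, s ∈ E.sec j ↔ ∃ a b : ChartRing j, s = a • u + b • v := by
  have hfin : FiniteDimensional K V := Module.finite_of_finrank_pos (by rw [E.finrank_eq]; simp)
  have hq : finrank K (V ⧸ L.genericFiber) = finrank K K := by
    have h1 := Submodule.finrank_quotient_add_finrank L.genericFiber
    have h2 := L.rank_one
    rw [E.finrank_eq] at h1
    rw [finrank_self]
    omega
  let ℓ : V →ₗ[K] K := (LinearEquiv.ofFinrankEq _ _ hq).toLinearMap ∘ₗ L.genericFiber.mkQ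
  have hker : ∀ s, ℓ s = 0 ↔ s ∈ L.genericFiber := fun s => by
    simp [ℓ]
  obtain ⟨x, hx⟩ := exists_generator_of_fg ((E.sec j).map (ℓ.restrictScalars (ChartRing j)))
    ((E.fg j).map _)
  have hxm : x ∈ (E.sec j).map (ℓ.restrictScalars (ChartRing j)) := by
    rw [hx]; exact Submodule.mem_span_singleton_self x
  obtain ⟨v, hv, hvx⟩ := hxm
  have hvx' : ℓ v = x := hvx
  have hcoef : ∀ s ∈ E.sec j, ∃ b : ChartRing j, ℓ s = b • ℓ v := fun s hs => by
    have : ℓ s ∈ (E.sec j).map (ℓ.restrictScalars (ChartRing j)) := ⟨s, hs, rfl⟩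
    rw [hx] at this
    obtain ⟨b, hb⟩ := Submodule.mem_span_singleton.1 this
    exact ⟨b, by rw [hvx', hb]⟩
  refine ⟨v, fun hvL => ?_, fun s => ⟨fun hs => ?_, ?_⟩⟩
  · have htop : (⊤ : Submodule K V) ≤ L.genericFiber := by
      rw [← E.genericFiber_eq, ← E.span_sec j]
      refine Submodule.span_le.2 fun s hs => ?_
      obtain ⟨b, hb⟩ := hcoef s hs
      rw [(hker v).2 hvL, smul_zero] at hb
      exact (hker s).1 hb
    have h1 := L.rank_one
    rw [top_le_iff.1 htop, finrank_top, E.finrank_eq] at h1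
    omega
  · obtain ⟨b, hb⟩ := hcoef s hs
    have hmem : s - b • v ∈ L.sec j := by
      rw [L.mem_sec_iff]
      refine ⟨sub_mem hs ((E.sec j).smul_mem b hv), (hker _).1 ?_⟩
      rw [map_sub, hb, ChartRing.smul_def, ChartRing.smul_def, map_smul, sub_self]
    rw [hu] at hmem
    obtain ⟨a, ha⟩ := Submodule.mem_span_singleton.1 hmem
    exact ⟨a, b, by rw [ha, sub_add_cancel]⟩
  · rintro ⟨a, b, rfl⟩
    refine add_mem (L.le j ?_) ((E.sec j).smul_mem b hv)
    rw [hu]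
    exact Submodule.mem_span_singleton.2 ⟨a, rfl⟩

/-- Frames of `E` over the two charts whose first vectors generate `L`, with upper triangular
transition matrix. -/
structure Frame (L : LineSubbundle E) where
  u : Fin 2 → V
  v : Fin 2 → V
  mem_line : ∀ j s, s ∈ L.sec j ↔ ∃ a : ChartRing j, s = a • u j
  mem_sec : ∀ j s, s ∈ E.sec j ↔ ∃ a b : ChartRing j, s = a • u j + b • v j
  indep : ∀ j, LinearIndependent K ![u j, v j]
  h : K
  u_one : u 1 = (RatFunc.X : K) ^ L.degree • u 0
  v_one : v 1 = h • u 0 + (RatFunc.X : K) ^ (E.degree - L.degree) • v 0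

theorem smul_C_mul (j : Fin 2) {c : ℂ} (hc : c ≠ 0) (a : ChartRing j) (w : V) :
    a • w = (ChartRing.C j c * a) • (RatFunc.C c⁻¹ : K) • w := by
  have h : (RatFunc.C c : K) ≠ 0 := by simpa using hc
  have h2 : ChartRing.toK j (ChartRing.C j c * a) =
    RatFunc.C c * ChartRing.toK j a := by rw [map_mul, ChartRing.toK_C]
  rw [ChartRing.smul_def, ChartRing.smul_def, smul_smul, h2, map_inv₀, mul_right_comm,
    mul_inv_cancel₀ h, one_mul]

theorem smul_C_inv (j : Fin 2) (c : ℂ) (a : ChartRing j) (w : V) :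
    a • (RatFunc.C c⁻¹ : K) • w = (ChartRing.C j c⁻¹ * a) • w := by
  have h2 : ChartRing.toK j (ChartRing.C j c⁻¹ * a) =
    RatFunc.C c⁻¹ * ChartRing.toK j a := by rw [map_mul, ChartRing.toK_C]
  rw [ChartRing.smul_def, ChartRing.smul_def, smul_smul, h2, mul_comm]

/-- The diagonal entries of the transition matrix are invertible on the overlap, hence constants
times powers of x, and the exponents are forced by the degrees of `L` and `E`. -/
theorem nonempty_frame (L : LineSubbundle E) : Nonempty L.Frame := by
  choose u hu0 hu using L.exists_generator
  choose v hv hsec using fun j => L.exists_complement j (hu j)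
  have hgen : ∀ j, L.genericFiber = Submodule.span K {u j} := fun j => by
    rw [← L.span_sec j, hu j, span_chart_span]
  have hline : ∀ j s, s ∈ L.sec j ↔ ∃ a : ChartRing j, s = a • u j := fun j s => by
    rw [hu j, Submodule.mem_span_singleton]
    simp only [eq_comm]
  have hind : ∀ j, LinearIndependent K ![u j, v j] := fun j => by
    rw [LinearIndependent.pair_iff' (hu0 j)]
    intro a ha
    exact hv j (by rw [hgen j, ← ha]; exact Submodule.mem_span_singleton.2 ⟨a, rfl⟩)
  have hind0 : ∀ a b a' b' : K, a • u 0 + b • v 0 = a' • u 0 + b' • v 0 → b = b' := by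
    intro a b a' b' hab
    have := LinearIndependent.pair_iff.1 (hind 0) (a - a') (b - b')
      (by rw [sub_smul, sub_smul, sub_add_sub_comm, hab, sub_self])
    exact sub_eq_zero.1 this.2
  -- the transition matrix
  obtain ⟨k, hk⟩ : ∃ k : K, k • u 0 = u 1 := by
    rw [← Submodule.mem_span_singleton, ← hgen 0, hgen 1]
    exact Submodule.mem_span_singleton_self _
  obtain ⟨h, k', hk'⟩ : ∃ h k' : K, v 1 = h • u 0 + k' • v 0 := by
    have hm : v 1 ∈ Submodule.span K (E.sec 0 : Set V) := by
      rw [E.span_sec, E.genericFiber_eq]; trivial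
    have hle : Submodule.span K (E.sec 0 : Set V) ≤ Submodule.span K {u 0, v 0} := by
      refine Submodule.span_le.2 fun s hs => ?_
      obtain ⟨a, b, rfl⟩ := (hsec 0 s).1 hs
      exact Submodule.mem_span_pair.2 ⟨_, _, rfl⟩
    obtain ⟨a, b, hab⟩ := Submodule.mem_span_pair.1 (hle hm)
    exact ⟨a, b, hab.symm⟩
  obtain ⟨c, d, hc, rfl⟩ : ∃ (c : ℂ) (d : ℤ), c ≠ 0 ∧ k = RatFunc.C c * RatFunc.X ^ d := by
    obtain ⟨m', hm'⟩ := L.exists_smul_mem_zero ((hline 1 _).2 ⟨1, (one_smul _ _).symm⟩)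
    obtain ⟨m, hm⟩ := L.exists_smul_mem_one ((hline 0 _).2 ⟨1, (one_smul _ _).symm⟩)
    obtain ⟨s₀, hs₀⟩ := (hline 0 _).1 hm'
    obtain ⟨s₁, hs₁⟩ := (hline 1 _).1 hm
    refine eq_C_mul_X_zpow (s₀ := s₀) (s₁ := s₁) (m := m) (m' := m') ?_ ?_
    · apply smul_left_injective K (hu0 0)
      change _ • _ = _ • _
      rw [mul_smul, hk, hs₀]
      rfl
    · apply smul_left_injective K (hu0 0)
      change _ • _ = _ • _
      rw [mul_smul, hk, hs₁]
      rfl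
  obtain ⟨c', d', hc', rfl⟩ : ∃ (c : ℂ) (d : ℤ), c ≠ 0 ∧ k' = RatFunc.C c * RatFunc.X ^ d := by
    obtain ⟨m', hm'⟩ := E.exists_smul_mem_zero
      ((hsec 1 (v 1)).2 ⟨0, 1, by rw [one_smul, zero_smul, zero_add]⟩)
    obtain ⟨m, hm⟩ := E.exists_smul_mem_one
      ((hsec 0 (v 0)).2 ⟨0, 1, by rw [one_smul, zero_smul, zero_add]⟩)
    obtain ⟨r₀, s₀, hs₀⟩ := (hsec 0 _).1 hm'
    obtain ⟨r₁, s₁, hs₁⟩ := (hsec 1 _).1 hm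
    refine eq_C_mul_X_zpow (s₀ := s₀) (s₁ := s₁) (m := m) (m' := m') ?_ ?_
    · rw [hk', smul_add, smul_smul, smul_smul] at hs₀
      exact (hind0 _ _ _ _ hs₀).symm
    · rw [hk', ← hk, ChartRing.smul_def, ChartRing.smul_def, smul_add, smul_smul, smul_smul,
        smul_smul, ← add_assoc, ← add_smul] at hs₁
      exact (hind0 0 (RatFunc.X⁻¹ ^ m) _ _ ((by rw [zero_smul, zero_add] :
        (0 : K) • u 0 + _ = _).trans hs₁)).symm
  have hcK : (RatFunc.C c : K) ≠ 0 := by simpa using hc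
  have hcK' : (RatFunc.C c' : K) ≠ 0 := by simpa using hc'
  have hL : L.degree = d := by
    refine L.toBundle.degree_eq (w₀ := ![u 0]) (w₁ := ![u 1]) ?_ ?_ ?_ ?_
      !![RatFunc.C c * RatFunc.X ^ d] ?_ hc (by simp)
    · exact LinearIndependent.of_subsingleton 0 (hu0 0)
    · exact LinearIndependent.of_subsingleton 0 (hu0 1)
    · rw [Matrix.range_cons, Matrix.range_empty, Set.union_empty, ← hu 0]
    · rw [Matrix.range_cons, Matrix.range_empty, Set.union_empty, ← hu 1]
    · intro a
      fin_cases a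
      simp [hk]
  have hspan : ∀ j, Submodule.span (ChartRing j) (Set.range ![u j, v j]) = E.sec j := by
    intro j
    ext s
    rw [hsec j, Matrix.range_cons, Matrix.range_cons, Matrix.range_empty, Set.union_empty,
      Set.singleton_union, Submodule.mem_span_pair]
    simp only [eq_comm]
  have hE : E.degree = d + d' := by
    refine E.toBundle.degree_eq (hind 0) (hind 1) (hspan 0) (hspan 1)
      !![RatFunc.C c * RatFunc.X ^ d, h; 0, RatFunc.C c' * RatFunc.X ^ d'] ?_
      (mul_ne_zero hc hc') ?_
    · intro a
      fin_cases a
      · simp [← hk]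
      · simp [hk']
    · rw [Matrix.det_fin_two_of, mul_zero, sub_zero, zpow_add₀ ratX_ne_zero, map_mul]
      ring
  -- The constants are absorbed into the frame over the chart at ∞.
  refine ⟨⟨![u 0, (RatFunc.C c⁻¹ : K) • u 1], ![v 0, (RatFunc.C c'⁻¹ : K) • v 1], ?_, ?_, ?_,
    RatFunc.C c'⁻¹ * h, ?_, ?_⟩⟩
  · intro j s
    fin_cases j
    · exact hline 0 s
    · refine (hline 1 s).trans ⟨?_, ?_⟩
      · rintro ⟨a, rfl⟩
        exact ⟨_, smul_C_mul 1 hc a _⟩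
      · rintro ⟨a, rfl⟩
        exact ⟨_, smul_C_inv 1 c a _⟩
  · intro j s
    fin_cases j
    · exact hsec 0 s
    · refine (hsec 1 s).trans ⟨?_, ?_⟩
      · rintro ⟨a, b, rfl⟩
        exact ⟨_, _, congrArg₂ (· + ·) (smul_C_mul 1 hc a _) (smul_C_mul 1 hc' b _)⟩
      · rintro ⟨a, b, rfl⟩
        exact ⟨_, _, congrArg₂ (· + ·) (smul_C_inv 1 c a _) (smul_C_inv 1 c' b _)⟩
  · intro j
    fin_cases j
    · exact hind 0
    · have h1 := LinearIndependent.pair_iff.1 (hind 1)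
      refine LinearIndependent.pair_iff.2 fun a b hab => ?_
      change a • (RatFunc.C c⁻¹ : K) • u 1 + b • (RatFunc.C c'⁻¹ : K) • v 1 = 0 at hab
      rw [smul_smul, smul_smul] at hab
      have := h1 _ _ hab
      simpa [hc, hc'] using this
  · change (RatFunc.C c⁻¹ : K) • u 1 = _ • u 0
    rw [← hk, smul_smul, hL, map_inv₀, inv_mul_cancel_left₀ hcK]
  · change (RatFunc.C c'⁻¹ : K) • v 1 = _ • u 0 + _ • v 0
    rw [hk', smul_add, smul_smul, smul_smul, hL, hE, map_inv₀, inv_mul_cancel_left₀ hcK',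
      add_sub_cancel_left]

end LineSubbundle

/-! ### Orders of vanishing and sections of `𝒪(e)` -/

/-- The zero of the local coordinate `unif t`. -/
noncomputable def center : OnePoint ℂ → ℂ
  | some t => t
  | none => 0

theorem unif_eq (t : OnePoint ℂ) :
    unif t = (Polynomial.X - Polynomial.C (center t) : Polynomial ℂ) := by
  cases t with
  | infty => exact ((congrArg (Polynomial.X - ·) Polynomial.C_0).trans (sub_zero _)).symm
  | coe t => rfl

/-- The order of vanishing at `t`. -/
noncomputable def ordAt (t : OnePoint ℂ) (a : ChartRing (chartIdx t)) : ℕ :=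
  Polynomial.rootMultiplicity (center t) (a : Polynomial ℂ)

/-- A unit multiple of `unif t ^ ordAt t a`. -/
theorem exists_eq_unif_pow_mul (t : OnePoint ℂ) (n : ℕ) {a : ChartRing (chartIdx t)}
    (ha : a ≠ 0) :
    ∃ b : ChartRing (chartIdx t), a = unif t ^ ordAt t a * b ∧ IsUnit (ThickRing.mk t n b) := by
  obtain ⟨b, hb, hnd⟩ : ∃ b : ChartRing (chartIdx t),
      a = unif t ^ ordAt t a * b ∧ ¬ unif t ∣ b := by
    rw [unif_eq]
    exact Polynomial.exists_eq_pow_rootMultiplicity_mul_and_not_dvd (a : Polynomial ℂ) ha (center t)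
  refine ⟨b, hb, ?_⟩
  · have hcop : IsCoprime (unif t ^ n) b := by
      rw [unif_eq] at hnd ⊢
      exact IsCoprime.pow_left (R := Polynomial ℂ)
        (((Polynomial.irreducible_X_sub_C _).coprime_iff_not_dvd).2 hnd)
    obtain ⟨x, y, hxy⟩ := hcop
    have hx : ThickRing.mk t n x * thickUnif t n ^ n + ThickRing.mk t n y * ThickRing.mk t n b =
        1 := by
      have h := congrArg (ThickRing.mk t n) hxy
      rwa [map_add, map_mul, map_mul, map_pow, map_one] at h
    rw [thickUnif_pow, mul_zero, zero_add] at hx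
    exact IsUnit.of_mul_eq_one_right _ hx

/-- The truncated discrete valuation ring has only powers of the uniformizer up to units; zero is
the case `k = n`. -/
theorem thick_factor (t : OnePoint ℂ) (n : ℕ) (a : ThickRing t n) :
    ∃ k ≤ n, ∃ b, IsUnit b ∧ a = thickUnif t n ^ k * b := by
  obtain ⟨p, rfl⟩ : ∃ p, ThickRing.mk t n p = a := Ideal.Quotient.mk_surjective a
  by_cases hp : p = 0
  · exact ⟨n, le_rfl, 1, isUnit_one, by rw [hp, map_zero, thickUnif_pow, zero_mul]⟩
  obtain ⟨b, hb, hu⟩ := exists_eq_unif_pow_mul t n hp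
  have hpb : ThickRing.mk t n p = thickUnif t n ^ ordAt t p * ThickRing.mk t n b := by
    rw [thickUnif, ← map_pow, ← map_mul, ← hb]
  rcases le_total (ordAt t p) n with h | h
  · exact ⟨_, h, _, hu, hpb⟩
  · refine ⟨n, le_rfl, 1, isUnit_one, ?_⟩
    rw [hpb, ← Nat.sub_add_cancel h, pow_add, thickUnif_pow]
    simp

/-- A nonzero section of 𝒪(e) has e zeros with multiplicity: `natDegree` counts those in ℂ and
`natTrailingDegree` in the other chart counts those at ∞. -/
theorem sum_ordAt_le (D : EffDivisor) (g : ∀ j, ChartRing j) (h₀ : g 0 ≠ 0) {e : ℤ}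
    (h : ChartRing.toK 1 (g 1) = RatFunc.X ^ (-e) * ChartRing.toK 0 (g 0)) :
    ((∑ i, ordAt (D.pt i) (g (chartIdx (D.pt i))) : ℕ) : ℤ) ≤ e := by
  classical
  rw [← natDegree_add_natTrailingDegree_eq h₀ h]
  norm_cast
  let f : Option ℂ → ℕ := fun t => ordAt t (g (chartIdx t))
  let S : Finset (Option ℂ) := Finset.univ.image D.pt
  have hS : ∑ i, ordAt (D.pt i) (g (chartIdx (D.pt i))) = ∑ t ∈ S, f t :=
    (Finset.sum_image (f := f) (fun a _ b _ hab => D.pt_injective hab)).symm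
  -- The point ∞ is added to the support even if it is not in `D`; its contribution is nonnegative.
  have hsub : S ⊆ Finset.insertNone (Finset.eraseNone S) := by
    rw [Finset.insertNone_eraseNone]
    exact Finset.subset_insert _ _
  have hfin : ∑ x ∈ Finset.eraseNone S, f (some x) ≤ Polynomial.natDegree (g 0) := by
    have hg : (g 0 : Polynomial ℂ) ≠ 0 := h₀
    calc ∑ x ∈ Finset.eraseNone S, f (some x)
        = ∑ x ∈ Finset.eraseNone S, (Polynomial.roots (g 0)).count x :=
          Finset.sum_congr rfl fun x _ => (Polynomial.count_roots (p := (g 0 : Polynomial ℂ))).symm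
      _ ≤ ∑ x ∈ Finset.eraseNone S ∪ (Polynomial.roots (g 0)).toFinset,
            (Polynomial.roots (g 0)).count x :=
          Finset.sum_le_sum_of_subset Finset.subset_union_left
      _ = (Polynomial.roots (g 0)).card :=
          Multiset.sum_count_eq_card fun x hx =>
            Finset.mem_union_right _ (Multiset.mem_toFinset.2 hx)
      _ ≤ _ := Polynomial.card_roots' _
  calc _ = ∑ t ∈ S, f t := hS
    _ ≤ ∑ t ∈ Finset.insertNone (Finset.eraseNone S), f t := Finset.sum_le_sum_of_subset hsub
    _ = f none + ∑ x ∈ Finset.eraseNone S, f (some x) := Finset.sum_insertNone _ _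
    _ ≤ Polynomial.natTrailingDegree (g 1) + Polynomial.natDegree (g 0) :=
        add_le_add (Polynomial.rootMultiplicity_eq_natTrailingDegree').le hfin
    _ = _ := add_comm _ _

/-- The product of the powers (x − t_i)^{N_i} over the finite points works: as a section of 𝒪(m), it
vanishes at ∞ to order m minus its degree. -/
theorem exists_section (D : EffDivisor) (N : Fin D.ν → ℕ) {m : ℕ} (hm : ∑ i, N i ≤ m) :
    ∃ g : ∀ j, ChartRing j, g 0 ≠ 0 ∧
      ChartRing.toK 1 (g 1) = RatFunc.X ^ (-(m : ℤ)) * ChartRing.toK 0 (g 0) ∧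
      ∀ i, unif (D.pt i) ^ N i ∣ g (chartIdx (D.pt i)) := by
  classical
  let d : Fin D.ν → ℕ := fun i => if D.pt i = OnePoint.infty then 0 else N i
  let p : Fin D.ν → Polynomial ℂ := fun i =>
    (Polynomial.X - Polynomial.C (center (D.pt i))) ^ d i
  let g₀ : Polynomial ℂ := ∏ i, p i
  have hd : ∀ i, d i ≤ N i := fun i => by dsimp only [d]; split_ifs <;> omega
  have hdeg : g₀.natDegree = ∑ i, d i := by
    rw [Polynomial.natDegree_prod _ _ fun i _ => pow_ne_zero _ (Polynomial.X_sub_C_ne_zero _)]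
    simp
  have hle : g₀.natDegree ≤ m := hdeg.trans_le ((Finset.sum_le_sum fun i _ => hd i).trans hm)
  have hg₀ : g₀ ≠ 0 :=
    Finset.prod_ne_zero_iff.2 fun i _ => pow_ne_zero _ (Polynomial.X_sub_C_ne_zero _)
  let g : ∀ j, ChartRing j := Fin.cons g₀ (Fin.cons (g₀.reflect m) finZeroElim)
  refine ⟨g, hg₀, ?_, fun i => ?_⟩
  · change ChartRing.toK 1 (g₀.reflect m) = _ * ChartRing.toK 0 g₀
    rw [← toK_one_reflect g₀ m hle, zpow_neg, zpow_natCast, mul_comm,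
      mul_inv_cancel_right₀ (pow_ne_zero _ ratX_ne_zero)]
  · have hcase : (∃ t : ℂ, D.pt i = (t : OnePoint ℂ)) ∨ D.pt i = OnePoint.infty := by
      cases D.pt i with
      | infty => exact Or.inr rfl
      | coe t => exact Or.inl ⟨t, rfl⟩
    rcases hcase with ⟨t, ht⟩ | ht
    · have hdi : d i = N i := if_neg (by rw [ht]; exact OnePoint.coe_ne_infty t)
      have hdvd : p i ∣ g₀ := Finset.dvd_prod_of_mem p (Finset.mem_univ i)
      simp only [p, hdi] at hdvd
      rw [ht] at hdvd ⊢
      exact hdvd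
    · have hdi : d i = 0 := if_pos ht
      -- The degree uses up only the orders at finite points, which leaves at least `N i` for ∞.
      have hlt : g₀.natDegree + N i ≤ m := by
        rw [hdeg, ← Finset.add_sum_erase _ _ (Finset.mem_univ i), hdi, zero_add, add_comm]
        refine le_trans ?_ hm
        rw [← Finset.add_sum_erase _ N (Finset.mem_univ i)]
        exact Nat.add_le_add_left (Finset.sum_le_sum fun i _ => hd i) _
      have hdvd : (Polynomial.X ^ N i : Polynomial ℂ) ∣ g₀.reflect m := by
        rw [Polynomial.X_pow_dvd_iff]
        intro k hk
        rw [Polynomial.coeff_reflect, Polynomial.revAt_le (by omega)]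
        exact Polynomial.coeff_eq_zero_of_natDegree_lt (by omega)
      rw [ht]
      exact hdvd

/-! ### Lengths over `𝒪_{n[t]}` -/

section Length

variable {R M : Type*} [CommRing R] [AddCommGroup M] [Module R M]

theorem length_mono {A B : Submodule R M} (h : A ≤ B) : Module.length R A ≤ Module.length R B :=
  Module.length_le_of_injective (Submodule.inclusion h) (Submodule.inclusion_injective h)

theorem length_add_quotient {A B : Submodule R M} (h : A ≤ B) :
    Module.length R B = Module.length R A + Module.length R (B ⧸ A.submoduleOf B) := by
  refine Module.length_eq_add_of_exact (Submodule.inclusion h) (A.submoduleOf B).mkQ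
    (Submodule.inclusion_injective h) (Submodule.mkQ_surjective _) ?_
  intro x
  rw [Submodule.mkQ_apply, Submodule.Quotient.mk_eq_zero]
  constructor
  · intro hx
    exact ⟨⟨x, hx⟩, rfl⟩
  · rintro ⟨y, rfl⟩
    exact y.2

/-- Additivity of length combined with the isomorphism A/(A ∩ B) ≅ (A + B)/B. -/
theorem length_sup_add_inf (A B : Submodule R M) :
    Module.length R (A ⊔ B : Submodule R M) + Module.length R (A ⊓ B : Submodule R M) =
      Module.length R A + Module.length R B := by
  have e := LinearMap.quotientInfEquivSupQuotient A B
  have h1 := length_add_quotient (inf_le_left : A ⊓ B ≤ A)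
  have h2 := length_add_quotient (le_sup_right : B ≤ A ⊔ B)
  have h3 : Module.length R (A ⧸ (A ⊓ B).submoduleOf A) =
      Module.length R ((A ⊔ B : Submodule R M) ⧸ B.submoduleOf (A ⊔ B)) := by
    exact e.length_eq
  rw [h1, h2, h3]
  ring

theorem eq_of_length_eq {A B : Submodule R M} (h : A ≤ B)
    (hl : Module.length R B ≤ Module.length R A) (hfin : Module.length R A ≠ ⊤) : A = B := by
  refine le_antisymm h fun x hx => ?_
  have h1 := length_add_quotient h
  have h0 : Module.length R (B ⧸ A.submoduleOf B) = 0 := by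
    have hB := ne_top_of_le_ne_top hfin hl
    have hQ : Module.length R (B ⧸ A.submoduleOf B) ≠ ⊤ := by
      intro hq
      rw [hq, add_top] at h1
      exact hB h1
    lift Module.length R (B ⧸ A.submoduleOf B) to ℕ using hQ with q
    lift Module.length R A to ℕ using hfin with a
    lift Module.length R B to ℕ using hB with b
    norm_cast at h1 hl ⊢
    omega
  have := Module.length_eq_zero_iff.1 h0
  have hx' : (Submodule.Quotient.mk ⟨x, hx⟩ : B ⧸ A.submoduleOf B) = 0 := Subsingleton.elim _ _
  exact (Submodule.Quotient.mk_eq_zero (A.submoduleOf B)).1 hx'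

theorem length_le_map_add {N : Type*} [AddCommGroup N] [Module R N] (f : M →ₗ[R] N)
    (A : Submodule R M) :
    Module.length R A = Module.length R (A ⊓ LinearMap.ker f : Submodule R M) +
      Module.length R (A.map f) := by
  refine Module.length_eq_add_of_exact (Submodule.inclusion inf_le_left) (f.submoduleMap A)
    (Submodule.inclusion_injective _) (LinearMap.submoduleMap_surjective _ _) ?_
  intro x
  constructor
  · intro h
    exact ⟨⟨x, x.2, congrArg Subtype.val h⟩, rfl⟩
  · rintro ⟨y, rfl⟩
    exact Subtype.ext y.2.2

end Length

/-- In the chain spanned by z, ϖz, ϖ²z, … each quotient is zero or simple, since elements outside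
the maximal ideal are units. -/
theorem length_span_singleton_le (t : OnePoint ℂ) (n : ℕ) {M : Type*} [AddCommGroup M]
    [Module (ThickRing t n) M] (o : ℕ) (z : M) (hz : thickUnif t n ^ o • z = 0) :
    Module.length (ThickRing t n) (Submodule.span (ThickRing t n) {z}) ≤ o := by
  induction o generalizing z with
  | zero =>
    rw [pow_zero, one_smul] at hz
    rw [hz, Submodule.span_zero_singleton, Module.length_bot]
    exact zero_le
  | succ o ih =>
    have hle : Submodule.span (ThickRing t n) {thickUnif t n • z} ≤
        Submodule.span (ThickRing t n) {z} :=
      Submodule.span_le.2 (Set.singleton_subset_iff.2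
        (Submodule.smul_mem _ _ (Submodule.mem_span_singleton_self z)))
    rw [length_add_quotient hle]
    push_cast
    refine add_le_add (ih _ (by rw [smul_smul, ← pow_succ, hz])) ?_
    rcases subsingleton_or_nontrivial (Submodule.span (ThickRing t n) {z} ⧸
      (Submodule.span (ThickRing t n) {thickUnif t n • z}).submoduleOf
        (Submodule.span (ThickRing t n) {z})) with h | h
    · rw [Module.length_eq_zero]
      exact zero_le
    · refine (Module.length_eq_one_iff.2 ?_).le
      rw [isSimpleModule_iff_toSpanSingleton_surjective]
      refine ⟨h, fun x hx y => ?_⟩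
      obtain ⟨⟨x, hxm⟩, rfl⟩ := Submodule.Quotient.mk_surjective _ x
      obtain ⟨⟨y, hym⟩, rfl⟩ := Submodule.Quotient.mk_surjective _ y
      obtain ⟨a, rfl⟩ := Submodule.mem_span_singleton.1 hxm
      obtain ⟨b, rfl⟩ := Submodule.mem_span_singleton.1 hym
      obtain ⟨k, -, c, hc, rfl⟩ := thick_factor t n a
      rcases Nat.eq_zero_or_pos k with rfl | hk
      · obtain ⟨c', hc'⟩ := hc.exists_left_inv
        refine ⟨b * c', ?_⟩
        rw [LinearMap.toSpanSingleton_apply, ← Submodule.Quotient.mk_smul]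
        congr 1
        apply Subtype.ext
        change (b * c') • (_ * c) • z = b • z
        rw [pow_zero, one_mul, smul_smul, mul_assoc, hc', mul_one]
      · refine absurd ((Submodule.Quotient.mk_eq_zero _).2 ?_) hx
        refine Submodule.mem_span_singleton.2 ⟨thickUnif t n ^ (k - 1) * c, ?_⟩
        change _ = (thickUnif t n ^ k * c) • z
        rw [smul_smul, mul_right_comm, ← pow_succ, Nat.sub_add_cancel hk]

variable {E : RankTwoBundle V}

/-! ### Restrictions to `n[t]` -/

theorem RankTwoBundle.res_surjective (E : RankTwoBundle V) (t : OnePoint ℂ) (n : ℕ) :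
    Function.Surjective (E.res t n) :=
  Submodule.mkQ_surjective _

theorem RankTwoBundle.res_eq_zero_iff (E : RankTwoBundle V) (t : OnePoint ℂ) (n : ℕ)
    (s : E.sec (chartIdx t)) : E.res t n s = 0 ↔ ∃ s', s = unif t ^ n • s' := by
  refine (Submodule.Quotient.mk_eq_zero _).trans ?_
  rw [Submodule.ideal_span_singleton_smul]
  constructor
  · rintro ⟨s', -, h⟩
    exact ⟨s', h.symm⟩
  · rintro ⟨s', h⟩
    exact ⟨s', trivial, h.symm⟩

theorem thick_mk_surjective (t : OnePoint ℂ) (n : ℕ) : Function.Surjective (ThickRing.mk t n) :=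
  Ideal.Quotient.mk_surjective

theorem thick_mk_eq_zero_iff (t : OnePoint ℂ) (n : ℕ) (a : ChartRing (chartIdx t)) :
    ThickRing.mk t n a = 0 ↔ unif t ^ n ∣ a :=
  Ideal.Quotient.eq_zero_iff_mem.trans Ideal.mem_span_singleton

/-- A submodule of multiples of `z` by elements annihilated by the `o`-th power of the generator of
the maximal ideal has length at most `o`. -/
theorem length_le_of_forall_exists_smul (t : OnePoint ℂ) (n : ℕ) {M : Type*} [AddCommGroup M]
    [Module (ThickRing t n) M] (S : Submodule (ThickRing t n) M) (z : M) (o : ℕ)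
    (h : ∀ x ∈ S, ∃ b : ThickRing t n, x = b • z ∧ thickUnif t n ^ o * b = 0) :
    Module.length (ThickRing t n) S ≤ o := by
  rcases le_total o n with ho | ho
  · refine (length_mono (B := Submodule.span _ {thickUnif t n ^ (n - o) • z}) fun x hx => ?_).trans
      (length_span_singleton_le t n o _ ?_)
    · obtain ⟨b, rfl, hb⟩ := h x hx
      obtain ⟨c, rfl⟩ := thickUnif_dvd t n o ho b hb
      exact Submodule.mem_span_singleton.2 ⟨c, by rw [smul_smul, mul_comm]⟩
    · rw [smul_smul, ← pow_add, Nat.add_sub_cancel' ho, thickUnif_pow, zero_smul]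
  · refine (length_mono (B := Submodule.span _ {z}) fun x hx => ?_).trans
      ((length_span_singleton_le t n n z ?_).trans (by exact_mod_cast ho))
    · obtain ⟨b, rfl, -⟩ := h x hx
      exact Submodule.mem_span_singleton.2 ⟨b, rfl⟩
    · rw [thickUnif_pow, zero_smul]

theorem thickUnif_pow_ordAt_mul_eq_zero (t : OnePoint ℂ) (n : ℕ) {q : ChartRing (chartIdx t)}
    (hq : q ≠ 0) {b : ThickRing t n} (h : b * ThickRing.mk t n q = 0) :
    thickUnif t n ^ ordAt t q * b = 0 := by
  obtain ⟨c, hc, hu⟩ := exists_eq_unif_pow_mul t n hq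
  have h1 : ThickRing.mk t n q = thickUnif t n ^ ordAt t q * ThickRing.mk t n c := by
    rw [thickUnif, ← map_pow, ← map_mul, ← hc]
  rw [h1, ← mul_assoc] at h
  rw [mul_comm]
  exact (IsUnit.mul_left_eq_zero hu).1 h

namespace LineSubbundle.Frame

variable {L : LineSubbundle E} (F : L.Frame)

theorem u_mem_line (j : Fin 2) : F.u j ∈ L.sec j :=
  (F.mem_line j _).2 ⟨1, (one_smul _ _).symm⟩

theorem u_mem (j : Fin 2) : F.u j ∈ E.sec j := L.le j (F.u_mem_line j)

theorem v_mem (j : Fin 2) : F.v j ∈ E.sec j :=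
  (F.mem_sec j _).2 ⟨0, 1, by rw [zero_smul, zero_add, one_smul]⟩

theorem coords_eq (j : Fin 2) {a b a' b' : K}
    (h : a • F.u j + b • F.v j = a' • F.u j + b' • F.v j) : a = a' ∧ b = b' := by
  have := LinearIndependent.pair_iff.1 (F.indep j) (a - a') (b - b')
    (by rw [sub_smul, sub_smul, sub_add_sub_comm, h, sub_self])
  exact ⟨sub_eq_zero.1 this.1, sub_eq_zero.1 this.2⟩

theorem u_ne_zero (j : Fin 2) : F.u j ≠ 0 := by
  intro h
  have := (F.coords_eq j (a := 1) (b := 0) (a' := 0) (b' := 0) (by simp [h])).1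
  exact one_ne_zero this

theorem chart_coords_eq (j : Fin 2) {a b a' b' : ChartRing j}
    (h : a • F.u j + b • F.v j = a' • F.u j + b' • F.v j) : a = a' ∧ b = b' := by
  have := F.coords_eq j (a := ChartRing.toK j a) (b := ChartRing.toK j b)
    (a' := ChartRing.toK j a') (b' := ChartRing.toK j b') h
  exact ⟨toK_injective j this.1, toK_injective j this.2⟩

/-- The restriction of the first frame vector to `n[t]`. -/
noncomputable def uRes (t : OnePoint ℂ) (n : ℕ) : E.Restr t n :=
  E.res t n ⟨F.u (chartIdx t), F.u_mem _⟩

/-- The restriction of the second frame vector to `n[t]`. -/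
noncomputable def vRes (t : OnePoint ℂ) (n : ℕ) : E.Restr t n :=
  E.res t n ⟨F.v (chartIdx t), F.v_mem _⟩

theorem res_eq (t : OnePoint ℂ) (n : ℕ) (s : E.sec (chartIdx t)) {a b : ChartRing (chartIdx t)}
    (h : (s : V) = a • F.u (chartIdx t) + b • F.v (chartIdx t)) :
    E.res t n s = ThickRing.mk t n a • F.uRes t n + ThickRing.mk t n b • F.vRes t n := by
  have hs : s = a • (⟨F.u (chartIdx t), F.u_mem _⟩ : E.sec (chartIdx t)) +
      b • (⟨F.v (chartIdx t), F.v_mem _⟩ : E.sec (chartIdx t)) := Subtype.ext h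
  rw [hs, map_add, E.res_smul, E.res_smul]
  rfl

theorem exists_coords (t : OnePoint ℂ) (n : ℕ) (x : E.Restr t n) :
    ∃ a b : ThickRing t n, x = a • F.uRes t n + b • F.vRes t n := by
  obtain ⟨s, rfl⟩ := E.res_surjective t n x
  obtain ⟨a, b, h⟩ := (F.mem_sec _ s).1 s.2
  exact ⟨_, _, F.res_eq t n s h⟩

/-- Together with `exists_coords`: the restricted frame is a basis of E|_{n[t]}. -/
theorem coords_eq_zero (t : OnePoint ℂ) (n : ℕ) {a b : ThickRing t n}
    (h : a • F.uRes t n + b • F.vRes t n = 0) : a = 0 ∧ b = 0 := by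
  obtain ⟨a, rfl⟩ := thick_mk_surjective t n a
  obtain ⟨b, rfl⟩ := thick_mk_surjective t n b
  have hm : a • F.u (chartIdx t) + b • F.v (chartIdx t) ∈ E.sec (chartIdx t) :=
    (F.mem_sec _ _).2 ⟨a, b, rfl⟩
  rw [← F.res_eq t n ⟨_, hm⟩ rfl, E.res_eq_zero_iff] at h
  obtain ⟨⟨s', hs'⟩, h⟩ := h
  obtain ⟨c, d, rfl⟩ := (F.mem_sec _ s').1 hs'
  have h' : a • F.u (chartIdx t) + b • F.v (chartIdx t) =
      unif t ^ n • (c • F.u (chartIdx t) + d • F.v (chartIdx t)) := congrArg Subtype.val h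
  rw [smul_add, smul_smul, smul_smul] at h'
  obtain ⟨h1, h2⟩ := F.chart_coords_eq _ h'
  exact ⟨(thick_mk_eq_zero_iff t n _).2 ⟨c, h1⟩, (thick_mk_eq_zero_iff t n _).2 ⟨d, h2⟩⟩

theorem coords_res_eq (t : OnePoint ℂ) (n : ℕ) {a b a' b' : ThickRing t n}
    (h : a • F.uRes t n + b • F.vRes t n = a' • F.uRes t n + b' • F.vRes t n) :
    a = a' ∧ b = b' := by
  have := F.coords_eq_zero t n (a := a - a') (b := b - b')
    (by rw [sub_smul, sub_smul, sub_add_sub_comm, h, sub_self])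
  exact ⟨sub_eq_zero.1 this.1, sub_eq_zero.1 this.2⟩

theorem restr_eq (t : OnePoint ℂ) (n : ℕ) :
    L.restr t n = Submodule.span (ThickRing t n) {F.uRes t n} := by
  apply le_antisymm
  · refine Submodule.span_le.2 ?_
    rintro _ ⟨s, hs, rfl⟩
    obtain ⟨a, ha⟩ := (F.mem_line _ _).1 hs
    rw [F.res_eq t n s (a := a) (b := 0) (by rw [ha, zero_smul, add_zero]), map_zero, zero_smul,
      add_zero]
    exact Submodule.mem_span_singleton.2 ⟨_, rfl⟩
  · refine Submodule.span_le.2 (Set.singleton_subset_iff.2 (Submodule.subset_span ?_))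
    exact ⟨_, F.u_mem_line _, rfl⟩

theorem mem_restr_iff (t : OnePoint ℂ) (n : ℕ) (x : E.Restr t n) :
    x ∈ L.restr t n ↔ ∃ a : ThickRing t n, x = a • F.uRes t n := by
  rw [F.restr_eq, Submodule.mem_span_singleton]
  simp only [eq_comm]

end LineSubbundle.Frame

/-! ### Relative position of two line subbundles -/

namespace LineSubbundle

theorem ext_of_genericFiber_eq {L L' : LineSubbundle E} (h : L.genericFiber = L'.genericFiber) :
    L = L' := by
  have hsec : L.sec = L'.sec := by
    funext j
    ext s
    rw [L.mem_sec_iff, L'.mem_sec_iff, h]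
  obtain ⟨⟨_, _, _⟩, _, _, _⟩ := L
  obtain ⟨⟨_, _, _⟩, _, _, _⟩ := L'
  cases hsec
  rfl

theorem Frame.genericFiber_eq {L : LineSubbundle E} (F : L.Frame) (j : Fin 2) :
    L.genericFiber = Submodule.span K {F.u j} := by
  rw [← L.span_sec j]
  apply le_antisymm
  · refine Submodule.span_le.2 fun s hs => ?_
    obtain ⟨a, rfl⟩ := (F.mem_line j s).1 hs
    exact Submodule.mem_span_singleton.2 ⟨_, rfl⟩
  · exact Submodule.span_mono (Set.singleton_subset_iff.2 (F.u_mem_line j))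

/-- Two distinct line subbundles meet along a section of `𝒪(e)`, where
`e = deg E - deg L - deg L'`. -/
theorem exists_wedge {L L' : LineSubbundle E} (hne : L ≠ L') (F : L.Frame) (F' : L'.Frame) :
    ∃ p q : ∀ j, ChartRing j, (∀ j, F'.u j = p j • F.u j + q j • F.v j) ∧ (∀ j, q j ≠ 0) ∧
      ChartRing.toK 1 (q 1) =
        RatFunc.X ^ (-(E.degree - L.degree - L'.degree)) * ChartRing.toK 0 (q 0) := by
  choose p q hpq using fun j => (F.mem_sec j _).1 (F'.u_mem j)
  -- If `q j = 0`, the generator of `L'` lies on the generic fibre of `L`, and the two line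
  -- subbundles coincide.
  refine ⟨p, q, hpq, fun j hq => hne (ext_of_genericFiber_eq ?_), ?_⟩
  · have h1 := hpq j
    rw [hq, zero_smul, add_zero] at h1
    have hp : ChartRing.toK j (p j) ≠ 0 := fun h0 => F'.u_ne_zero j (by
      rw [h1, ChartRing.smul_def, h0, zero_smul])
    rw [F.genericFiber_eq j, F'.genericFiber_eq j, h1, ChartRing.smul_def]
    exact (Submodule.span_singleton_smul_eq hp.isUnit _).symm
  -- The transition matrix of `F` is triangular, so the `v`-coefficients transform by a power of x
  -- alone.
  · have h1 := F'.u_one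
    rw [hpq 0, hpq 1, F.u_one, F.v_one] at h1
    simp only [ChartRing.smul_def, smul_add, smul_smul] at h1
    rw [← add_assoc, ← add_smul] at h1
    have h2 := (F.coords_eq 0 h1).2
    rw [neg_sub, sub_eq_add_neg, ← sub_eq_add_neg, zpow_sub₀ ratX_ne_zero, div_mul_eq_mul_div,
      ← h2, mul_div_assoc, div_self (zpow_ne_zero _ ratX_ne_zero), mul_one]

/-- A multiple b·u' lies in `L` only if b·q = 0, which forces ϖ^{ord q}·b = 0. -/
theorem length_restr_inf_le {L L' : LineSubbundle E} (F : L.Frame) (F' : L'.Frame)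
    (t : OnePoint ℂ) (n : ℕ) {p q : ChartRing (chartIdx t)}
    (h : F'.u (chartIdx t) = p • F.u (chartIdx t) + q • F.v (chartIdx t)) (hq : q ≠ 0) :
    Module.length (ThickRing t n) (L.restr t n ⊓ L'.restr t n : Submodule _ _) ≤ ordAt t q := by
  refine length_le_of_forall_exists_smul t n _ (F'.uRes t n) _ ?_
  rintro x ⟨hx, hx'⟩
  obtain ⟨a, ha⟩ := (F.mem_restr_iff t n x).1 hx
  obtain ⟨b, hb⟩ := (F'.mem_restr_iff t n x).1 hx'
  refine ⟨b, hb, thickUnif_pow_ordAt_mul_eq_zero t n hq ?_⟩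
  rw [Frame.uRes, F.res_eq t n _ h, smul_add, smul_smul, smul_smul] at hb
  have hx0 : a • F.uRes t n + (0 : ThickRing t n) • F.vRes t n = x := by
    rw [zero_smul, add_zero, ha]
  exact (F.coords_res_eq t n (hx0.trans hb)).2.symm

end LineSubbundle

variable {D : EffDivisor}

/-- Complementary line subbundles have complementary fibres. -/
theorem LineSubbundle.restr_inf_eq_bot {L L' : LineSubbundle E} (hne : L ≠ L')
    (hdeg : E.degree = L.degree + L'.degree) (D : EffDivisor) (i : Fin D.ν) (n : ℕ) :
    L.restr (D.pt i) n ⊓ L'.restr (D.pt i) n = ⊥ := by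
  obtain ⟨F⟩ := L.nonempty_frame
  obtain ⟨F'⟩ := L'.nonempty_frame
  obtain ⟨p, q, hpq, hq0, hq⟩ := LineSubbundle.exists_wedge hne F F'
  have h := sum_ordAt_le D q (hq0 0) hq
  have h' : ∑ i, ordAt (D.pt i) (q (chartIdx (D.pt i))) = 0 := by omega
  have h3 := LineSubbundle.length_restr_inf_le F F' (D.pt i) n (hpq _) (hq0 _)
  rwa [Finset.sum_eq_zero_iff.1 h' i (Finset.mem_univ i), Nat.cast_zero, nonpos_iff_eq_zero,
    Module.length_eq_zero_iff, Submodule.subsingleton_iff_eq_bot] at h3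

namespace RefinedParabolic

variable (P : RefinedParabolic D E) (L : LineSubbundle E)

/-! ### Intersection lengths and stability indices -/

/-- The length of `l_{i,k} ∩ L|_{n_i[t_i]}`. -/
noncomputable def interLength (i : Fin D.ν) (k : Fin (D.mult i + 1)) : ℕ :=
  (Module.length (ThickRing (D.pt i) (D.mult i))
    (P.l i k ⊓ L.restr (D.pt i) (D.mult i) : Submodule _ _)).toNat

theorem coe_interLength (i : Fin D.ν) (k : Fin (D.mult i + 1)) :
    (P.interLength L i k : ℕ∞) = Module.length (ThickRing (D.pt i) (D.mult i))
      (P.l i k ⊓ L.restr (D.pt i) (D.mult i) : Submodule _ _) := by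
  refine ENat.natCast_toNat (ne_top_of_le_ne_top ?_ (length_mono inf_le_left))
  rw [P.length_eq]
  exact ENat.natCast_ne_top _

theorem interLength_zero (i : Fin D.ν) : P.interLength L i 0 = 0 := by
  have h := (P.coe_interLength L i 0).trans_le (length_mono inf_le_left)
  rw [P.length_eq] at h
  simpa using h

theorem interLength_succ (i : Fin D.ν) (k : Fin (D.mult i)) :
    P.interLength L i k.succ = P.interLength L i k.castSucc + P.jump L i k := by
  have hle : P.l i k.castSucc ⊓ L.restr (D.pt i) (D.mult i) ≤
      P.l i k.succ ⊓ L.restr (D.pt i) (D.mult i) :=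
    inf_le_inf_right _ (P.mono i (Fin.castSucc_lt_succ).le)
  have h := length_add_quotient hle
  rw [← P.coe_interLength, ← P.coe_interLength] at h
  have hq : ((P.jump L i k : ℕ) : ℕ∞) = Module.length (ThickRing (D.pt i) (D.mult i))
      (↥(P.l i k.succ ⊓ L.restr (D.pt i) (D.mult i)) ⧸
        (P.l i k.castSucc ⊓ L.restr (D.pt i) (D.mult i)).submoduleOf
          (P.l i k.succ ⊓ L.restr (D.pt i) (D.mult i))) := by
    refine ENat.natCast_toNat fun htop => ?_
    rw [htop, add_top] at h
    exact ENat.natCast_ne_top _ h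
  rw [← hq] at h
  exact_mod_cast h

/-- Adding l_{k+1} ∩ L to l_k stays inside l_{k+1}, so it raises the length by at most one. -/
theorem jump_le_one (i : Fin D.ν) (k : Fin (D.mult i)) : P.jump L i k ≤ 1 := by
  have h := length_sup_add_inf (P.l i k.castSucc)
    (P.l i k.succ ⊓ L.restr (D.pt i) (D.mult i))
  have hle : P.l i k.castSucc ≤ P.l i k.succ := P.mono i (Fin.castSucc_lt_succ).le
  have hsup : Module.length (ThickRing (D.pt i) (D.mult i))
      (P.l i k.castSucc ⊔ P.l i k.succ ⊓ L.restr (D.pt i) (D.mult i) : Submodule _ _) ≤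
      ((k.succ : ℕ) : ℕ∞) := by
    rw [← P.length_eq i k.succ]
    exact length_mono (sup_le hle inf_le_left)
  rw [← inf_assoc, inf_eq_left.2 hle, P.length_eq, ← P.coe_interLength, ← P.coe_interLength] at h
  have h2 := h.symm.le.trans (add_le_add_left hsup _)
  have h3 := P.interLength_succ L i k
  have h4 : (k.castSucc : ℕ) + P.interLength L i k.succ ≤
    (k.succ : ℕ) + P.interLength L i k.castSucc := by exact_mod_cast h2
  rw [Fin.val_castSucc, Fin.val_succ] at h4
  omega

theorem eps_eq (i : Fin D.ν) (k : Fin (D.mult i)) : P.eps L i k = 1 - 2 * (P.jump L i k : ℤ) := by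
  have h := P.jump_le_one L i k
  rw [eps]
  split_ifs with h0
  · rw [h0]; rfl
  · rw [show P.jump L i k = 1 by omega]; rfl

/-- The jumps telescope to an intersection length. The index `k` counts from zero, so the sum has k
+ 1 terms and reaches `k.succ`. -/
theorem sum_eps (i : Fin D.ν) (k : Fin (D.mult i)) :
    ∑ j ∈ Finset.Iic k, P.eps L i j = (k : ℤ) + 1 - 2 * P.interLength L i k.succ := by
  obtain ⟨m, hm⟩ := k
  induction m with
  | zero =>
    have h0 : (Finset.Iic ⟨0, hm⟩ : Finset (Fin (D.mult i))) = {⟨0, hm⟩} := by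
      ext x
      simp [Fin.le_def, Fin.ext_iff]
    rw [h0, Finset.sum_singleton, P.eps_eq, P.interLength_succ]
    have : P.interLength L i (Fin.castSucc ⟨0, hm⟩) = 0 := P.interLength_zero L i
    rw [this]
    simp
  | succ m ih =>
    have h0 : (Finset.Iic ⟨m + 1, hm⟩ : Finset (Fin (D.mult i))) =
        insert ⟨m + 1, hm⟩ (Finset.Iic ⟨m, by omega⟩) := by
      ext x
      simp only [Finset.mem_Iic, Finset.mem_insert, Fin.le_def, Fin.ext_iff]
      omega
    rw [h0, Finset.sum_insert (by simp [Fin.le_def]), ih (by omega), P.eps_eq,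
      P.interLength_succ L i ⟨m + 1, hm⟩]
    have : P.interLength L i (Fin.castSucc ⟨m + 1, hm⟩) =
      P.interLength L i (Fin.succ ⟨m, by omega⟩) := rfl
    rw [this]
    push_cast
    ring

theorem stab_eq (w : Weights D) :
    P.stab w L = (E.degree : ℝ) - 2 * (L.degree : ℝ) +
      ∑ i, ∑ k, w.w i k * (P.eps L i k : ℝ) := by
  unfold stab
  congr 1
  refine Finset.sum_congr rfl fun i _ => Finset.sum_congr rfl fun k _ => ?_
  rw [P.eps_eq]
  push_cast
  ring

variable {L}

/-- Inside l_k the two intersections span length at most k, and their overlap sits in L ∩ L', of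
length at most the order of `q`. -/
theorem interLength_add_le {L' : LineSubbundle E} (F : L.Frame) (F' : L'.Frame) (i : Fin D.ν)
    {p q : ChartRing (chartIdx (D.pt i))}
    (h : F'.u (chartIdx (D.pt i)) = p • F.u (chartIdx (D.pt i)) + q • F.v (chartIdx (D.pt i)))
    (hq : q ≠ 0) (k : Fin (D.mult i + 1)) :
    P.interLength L i k + P.interLength L' i k ≤ k + ordAt (D.pt i) q := by
  have h1 := length_sup_add_inf (P.l i k ⊓ L.restr (D.pt i) (D.mult i))
    (P.l i k ⊓ L'.restr (D.pt i) (D.mult i))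
  rw [← P.coe_interLength, ← P.coe_interLength] at h1
  have h2 : Module.length (ThickRing (D.pt i) (D.mult i))
      (P.l i k ⊓ L.restr (D.pt i) (D.mult i) ⊔ P.l i k ⊓ L'.restr (D.pt i) (D.mult i) :
        Submodule _ _) ≤ ((k : ℕ) : ℕ∞) := by
    rw [← P.length_eq i k]
    exact length_mono (sup_le inf_le_left inf_le_left)
  have h3 := (length_mono (inf_le_inf (inf_le_right : P.l i k ⊓ L.restr (D.pt i) (D.mult i) ≤ _)
    (inf_le_right : P.l i k ⊓ L'.restr (D.pt i) (D.mult i) ≤ _))).trans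
    (LineSubbundle.length_restr_inf_le F F' (D.pt i) (D.mult i) h hq)
  have h4 := h1.symm.le.trans (add_le_add h2 h3)
  exact_mod_cast h4

/-- In complementary degrees `q` is a nonzero constant, so E = L ⊕ L'. The intersections with
l_{i,k} are then independent, and equality of lengths makes them fill l_{i,k}. -/
theorem decomposable_of_eq {L' : LineSubbundle E} (hne : L ≠ L')
    (hdeg : E.degree = L.degree + L'.degree)
    (hl : ∀ i k, P.interLength L i k + P.interLength L' i k = k) : P.Decomposable := by
  obtain ⟨F⟩ := L.nonempty_frame
  obtain ⟨F'⟩ := L'.nonempty_frame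
  obtain ⟨p, q, hpq, hq0, hq⟩ := LineSubbundle.exists_wedge hne F F'
  have he : E.degree - L.degree - L'.degree = 0 := by omega
  rw [he] at hq
  obtain ⟨c, hc₀, hc₁⟩ := exists_C_of_section_zero (g₀ := q 0) (g₁ := q 1) (by simpa using hq)
  have hc : ∀ j, q j = ChartRing.C j c := by
    intro j
    fin_cases j
    · exact hc₀
    · exact hc₁
  have hc0 : c ≠ 0 := by
    rintro rfl
    exact hq0 0 (hc₀.trans Polynomial.C_0)
  refine ⟨L, L', fun j => ⟨?_, le_antisymm (sup_le (L.le j) (L'.le j)) fun s hs => ?_⟩,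
    fun i k => ?_⟩
  · rw [Submodule.disjoint_def]
    intro s hs hs'
    obtain ⟨a, rfl⟩ := (F.mem_line j s).1 hs
    obtain ⟨b, hb⟩ := (F'.mem_line j _).1 hs'
    rw [hpq j, smul_add, smul_smul, smul_smul] at hb
    have hb' : a • F.u j + (0 : ChartRing j) • F.v j =
        (b * p j) • F.u j + (b * q j) • F.v j := by
      rw [zero_smul, add_zero]
      exact hb
    obtain ⟨h1, h2⟩ := F.chart_coords_eq j hb'
    have hb0 : b = 0 := (mul_eq_zero.1 h2.symm).resolve_right (hq0 j)
    rw [h1, hb0, zero_mul, zero_smul]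
  · obtain ⟨a, b, rfl⟩ := (F.mem_sec j s).1 hs
    have hcc : ChartRing.C j c⁻¹ * q j = 1 := by
      rw [hc j]
      apply toK_injective j
      rw [map_mul, ChartRing.toK_C, ChartRing.toK_C, ← map_mul, inv_mul_cancel₀ hc0, map_one,
        map_one]
    have hv : F.v j = ChartRing.C j c⁻¹ • F'.u j - (ChartRing.C j c⁻¹ * p j) • F.u j := by
      rw [hpq j, smul_add, smul_smul, smul_smul, hcc, one_smul, add_sub_cancel_left]
    have hmu : F.u j ∈ L.sec j ⊔ L'.sec j := Submodule.mem_sup_left (F.u_mem_line j)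
    have hmu' : F'.u j ∈ L.sec j ⊔ L'.sec j := Submodule.mem_sup_right (F'.u_mem_line j)
    rw [hv]
    exact add_mem (Submodule.smul_mem _ _ hmu) (Submodule.smul_mem _ _
      (sub_mem (Submodule.smul_mem _ _ hmu') (Submodule.smul_mem _ _ hmu)))
  · have h3 := LineSubbundle.restr_inf_eq_bot hne hdeg D i (D.mult i)
    have hdisj : Disjoint (P.l i k ⊓ L.restr (D.pt i) (D.mult i))
        (P.l i k ⊓ L'.restr (D.pt i) (D.mult i)) :=
      (disjoint_iff.2 h3).mono inf_le_right inf_le_right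
    refine ⟨hdisj, (eq_of_length_eq (sup_le inf_le_left inf_le_left) ?_ ?_).symm⟩
    · have h1 := length_sup_add_inf (P.l i k ⊓ L.restr (D.pt i) (D.mult i))
        (P.l i k ⊓ L'.restr (D.pt i) (D.mult i))
      rw [disjoint_iff.1 hdisj, Module.length_bot, add_zero, ← P.coe_interLength,
        ← P.coe_interLength] at h1
      rw [h1, P.length_eq]
      exact_mod_cast (hl i k).ge
    · refine ne_top_of_le_ne_top (b := Module.length _ (P.l i k)) ?_
        (length_mono (sup_le inf_le_left inf_le_left))
      rw [P.length_eq]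
      exact ENat.natCast_ne_top _

end RefinedParabolic

/-! ### Summation by parts -/

theorem sum_Iic_eq_sum_range {n : ℕ} (X : ℕ → ℝ) (k : Fin n) :
    ∑ j ∈ Finset.Iic k, X (j : Fin n) = ∑ j ∈ Finset.range (k + 1), X j := by
  refine Finset.sum_bij (fun j _ => (j : ℕ)) ?_ ?_ ?_ ?_
  · intro a ha
    have : (a : ℕ) ≤ k := Fin.le_def.1 (Finset.mem_Iic.1 ha)
    exact Finset.mem_range.2 (by omega)
  · intro a _ b _ hab
    exact Fin.ext hab
  · intro b hb
    have hb' := Finset.mem_range.1 hb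
    exact ⟨⟨b, by omega⟩, Finset.mem_Iic.2 (Fin.le_def.2 (by simp; omega)), rfl⟩
  · intro a _
    rfl

theorem sum_range_mul_by_parts (W X : ℕ → ℝ) (n : ℕ) :
    ∑ k ∈ Finset.range n, W k * X k = W n * ∑ j ∈ Finset.range n, X j +
      ∑ k ∈ Finset.range n, (W k - W (k + 1)) * ∑ j ∈ Finset.range (k + 1), X j := by
  induction n with
  | zero => simp
  | succ n ih =>
    rw [Finset.sum_range_succ, ih, Finset.sum_range_succ X,
      Finset.sum_range_succ (fun k => (W k - W (k + 1)) * ∑ j ∈ Finset.range (k + 1), X j),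
      Finset.sum_range_succ X]
    ring

/-- Summation by parts for a sequence of weights. -/
theorem exists_sum_mul_eq {n : ℕ} (w : Fin n → ℝ) (h0 : ∀ k, 0 ≤ w k) (h1 : ∀ k, w k ≤ 1)
    (hw : Antitone w) :
    ∃ c : Fin n → ℝ, (∀ k, 0 ≤ c k) ∧ ∑ k, c k ≤ 1 ∧
      ∀ x : Fin n → ℝ, ∑ k, w k * x k = ∑ k, c k * ∑ j ∈ Finset.Iic k, x j := by
  -- Extending the weights by 0 removes the boundary term. The coefficients are the successive drops
  -- of the weights, with total the first weight.
  let W : ℕ → ℝ := fun m => if h : m < n then w ⟨m, h⟩ else 0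
  have hW : ∀ k : Fin n, W k = w k := fun k => dif_pos k.2
  have hWn : W n = 0 := dif_neg (lt_irrefl n)
  refine ⟨fun k => W k - W (k + 1), fun k => ?_, ?_, fun x => ?_⟩
  · change 0 ≤ W k - W (k + 1)
    rw [hW, sub_nonneg]
    by_cases h : (k : ℕ) + 1 < n
    · rw [show W (k + 1) = w ⟨k + 1, h⟩ from dif_pos h]
      exact hw (Fin.le_def.2 (Nat.le_succ _))
    · rw [show W (k + 1) = 0 from dif_neg h]
      exact h0 k
  · rw [Fin.sum_univ_eq_sum_range (fun k => W k - W (k + 1)), Finset.sum_range_sub', hWn, sub_zero]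
    by_cases h : 0 < n
    · exact (hW ⟨0, h⟩).trans_le (h1 _)
    · rw [show W 0 = 0 from dif_neg h]
      exact zero_le_one
  · let X : ℕ → ℝ := fun m => if h : m < n then x ⟨m, h⟩ else 0
    have hX : ∀ k : Fin n, x k = X k := fun k => by simp [X]
    simp only [hX, ← hW, sum_Iic_eq_sum_range X]
    rw [Fin.sum_univ_eq_sum_range (fun k => W k * X k), sum_range_mul_by_parts, hWn, zero_mul,
      zero_add, Fin.sum_univ_eq_sum_range
        (fun k => (W k - W (k + 1)) * ∑ j ∈ Finset.range (k + 1), X j)]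

/-- The weighted sum is a combination of the partial sums with nonnegative coefficients of total at
most 1; `0 ≤ B` covers a total below 1. -/
theorem sum_mul_le_of_partial_sums_le {n : ℕ} {w : Fin n → ℝ} (h0 : ∀ k, 0 ≤ w k)
    (h1 : ∀ k, w k ≤ 1) (hw : Antitone w) {x : Fin n → ℝ} {B : ℝ} (hB : 0 ≤ B)
    (h : ∀ k, ∑ j ∈ Finset.Iic k, x j ≤ B) : ∑ k, w k * x k ≤ B := by
  obtain ⟨c, hc0, hc1, hc⟩ := exists_sum_mul_eq w h0 h1 hw
  calc ∑ k, w k * x k = ∑ k, c k * ∑ j ∈ Finset.Iic k, x j := hc x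
    _ ≤ ∑ k, c k * B := Finset.sum_le_sum fun k _ => mul_le_mul_of_nonneg_left (h k) (hc0 k)
    _ = (∑ k, c k) * B := (Finset.sum_mul _ _ _).symm
    _ ≤ 1 * B := mul_le_mul_of_nonneg_right hc1 hB
    _ = B := one_mul B

theorem sum_sub_mul_eq {n : ℕ} (x : Fin n → ℝ) :
    ∑ k : Fin n, ((n : ℝ) - k) * x k = ∑ k, ∑ j ∈ Finset.Iic k, x j := by
  let X : ℕ → ℝ := fun m => if h : m < n then x ⟨m, h⟩ else 0
  have hX : ∀ k : Fin n, x k = X k := fun k => by simp [X]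
  simp only [hX, sum_Iic_eq_sum_range X]
  rw [Fin.sum_univ_eq_sum_range (fun k => ((n : ℝ) - k) * X k),
    sum_range_mul_by_parts (fun k => (n : ℝ) - k),
    Fin.sum_univ_eq_sum_range (fun k => ∑ j ∈ Finset.range (k + 1), X j), sub_self, zero_mul,
    zero_add]
  refine Finset.sum_congr rfl fun k _ => ?_
  push_cast
  ring

/-! ### Weights -/

namespace Weights

/-- Weights in the interior of the weight polytope. -/
noncomputable def interior (D : EffDivisor) : Weights D where
  -- Constant drops 1/M give every partial sum the same coefficient. The extra 1 in the denominator
  -- keeps all weights below 1, which is the slack needed in `interior_le_stab_add`.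
  w i k := ((D.mult i : ℝ) - k) / (1 + ∑ i, D.mult i : ℕ)
  nonneg i k := by
    have : (k : ℝ) ≤ D.mult i := by exact_mod_cast k.2.le
    exact div_nonneg (sub_nonneg.2 this) (Nat.cast_nonneg _)
  le_one i k := by
    have h : D.mult i ≤ 1 + ∑ i, D.mult i :=
      (Finset.single_le_sum (fun _ _ => Nat.zero_le _) (Finset.mem_univ i)).trans
        (Nat.le_add_left _ _)
    rw [div_le_one (by positivity)]
    have h2 : (D.mult i : ℝ) ≤ (1 + ∑ i, D.mult i : ℕ) := by exact_mod_cast h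
    have h3 : (0 : ℝ) ≤ k := Nat.cast_nonneg _
    linarith
  anti i k k' h := by
    have : (k : ℝ) ≤ k' := by exact_mod_cast h
    exact div_le_div_of_nonneg_right (by linarith) (Nat.cast_nonneg _)

/-- The vertex of the weight polytope with weights `1` up to the index `m i` for `i ∈ S`. -/
noncomputable def vertex (S : Finset (Fin D.ν)) (m : ∀ i, Fin (D.mult i)) : Weights D where
  w i k := if i ∈ S ∧ k ≤ m i then 1 else 0
  nonneg i k := by split_ifs <;> norm_num
  le_one i k := by split_ifs <;> norm_num
  anti i k k' h := by
    beta_reduce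
    by_cases hk : i ∈ S ∧ k' ≤ m i
    · rw [if_pos hk, if_pos ⟨hk.1, h.trans hk.2⟩]
    · rw [if_neg hk]
      split_ifs <;> norm_num

/-- Convex combinations of weights. -/
noncomputable def mix (w w' : Weights D) (τ : ℝ) (h0 : 0 ≤ τ) (h1 : τ ≤ 1) : Weights D where
  w i k := (1 - τ) * w.w i k + τ * w'.w i k
  nonneg i k := by
    have := w.nonneg i k
    have := w'.nonneg i k
    have : 0 ≤ 1 - τ := by linarith
    positivity
  le_one i k := by
    nlinarith [w.le_one i k, w'.le_one i k]
  anti i k k' h := by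
    have h2 := w.anti i h
    have h3 := w'.anti i h
    have : 0 ≤ 1 - τ := by linarith
    exact add_le_add (mul_le_mul_of_nonneg_left h2 this) (mul_le_mul_of_nonneg_left h3 h0)

end Weights

/-! ### Stability, tameness and existence of stable weights -/

namespace RefinedParabolic

variable (P : RefinedParabolic D E) (L : LineSubbundle E)

theorem stab_mix (w w' : Weights D) (τ : ℝ) (h0 : 0 ≤ τ) (h1 : τ ≤ 1) :
    P.stab (w.mix w' τ h0 h1) L = (1 - τ) * P.stab w L + τ * P.stab w' L := by
  have h : ∑ i, ∑ k, (w.mix w' τ h0 h1).w i k * (P.eps L i k : ℝ) =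
      (1 - τ) * ∑ i, ∑ k, w.w i k * (P.eps L i k : ℝ) +
        τ * ∑ i, ∑ k, w'.w i k * (P.eps L i k : ℝ) := by
    simp only [Finset.mul_sum, ← Finset.sum_add_distrib]
    refine Finset.sum_congr rfl fun i _ => Finset.sum_congr rfl fun k _ => ?_
    change ((1 - τ) * w.w i k + τ * w'.w i k) * _ = _
    ring
  rw [stab_eq, stab_eq, stab_eq, h]
  ring

theorem sum_eps_le_N (i : Fin D.ν) (k : Fin (D.mult i)) :
    ∑ j ∈ Finset.Iic k, P.eps L i j ≤ P.N L i :=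
  Finset.le_sup' (fun k' : Fin (D.mult i) => ∑ k ∈ Finset.Iic k', P.eps L i k)
    (Finset.mem_univ k)

theorem exists_N_eq (i : Fin D.ν) :
    ∃ k : Fin (D.mult i), P.N L i = ∑ j ∈ Finset.Iic k, P.eps L i j := by
  obtain ⟨k, -, hk⟩ := Finset.exists_mem_eq_sup' (s := Finset.univ)
    ⟨⟨0, D.mult_pos i⟩, Finset.mem_univ _⟩
    (fun k' : Fin (D.mult i) => ∑ k ∈ Finset.Iic k', P.eps L i k)
  exact ⟨k, hk⟩

/-- By summation by parts, the contribution of t_i is at most max(N_i(L), 0), whatever the weights.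
-/
theorem stab_le (w : Weights D) :
    P.stab w L ≤ ((E.degree - 2 * L.degree + ∑ i ∈ P.Iplus L, P.N L i : ℤ) : ℝ) := by
  have h : ∀ i, ∑ k, w.w i k * (P.eps L i k : ℝ) ≤ (if 0 < P.N L i then (P.N L i : ℝ) else 0) := by
    intro i
    refine sum_mul_le_of_partial_sums_le (w.nonneg i) (w.le_one i) (w.anti i) ?_ fun k => ?_
    · split_ifs with h0
      · exact_mod_cast h0.le
      · exact le_rfl
    · have h2 : ∑ j ∈ Finset.Iic k, (P.eps L i j : ℝ) ≤ P.N L i := by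
        exact_mod_cast P.sum_eps_le_N L i k
      split_ifs with h0
      · exact h2
      · exact h2.trans (by exact_mod_cast not_lt.1 h0)
  rw [stab_eq, Iplus, Finset.sum_filter]
  push_cast
  exact add_le_add_right (Finset.sum_le_sum fun i _ => h i) _

theorem Stable.tame {P : RefinedParabolic D E} {w : Weights D} (h : P.Stable w) : P.Tame := by
  intro L hL
  have h1 := (h L).trans_le (P.stab_le L w)
  have h2 : 0 < E.degree - 2 * L.degree + ∑ i ∈ P.Iplus L, P.N L i := by exact_mod_cast h1
  refine ⟨?_, by omega⟩
  rw [Finset.nonempty_iff_ne_empty]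
  intro h0
  rw [h0, Finset.sum_empty] at h2
  omega

/-- The bound of `stab_le` is attained at the vertex that cuts off each i ∈ I⁺_L at an index where
N_i(L) is reached. If deg E > 2 deg L, it is positive without tameness. -/
theorem Tame.exists_weights_pos {P : RefinedParabolic D E} (h : P.Tame) (L : LineSubbundle E) :
    ∃ w : Weights D, 0 < P.stab w L := by
  choose m hm using P.exists_N_eq L
  refine ⟨Weights.vertex (P.Iplus L) m, ?_⟩
  have hsum : ∑ i, ∑ k, (Weights.vertex (P.Iplus L) m).w i k * (P.eps L i k : ℝ) =
      ((∑ i ∈ P.Iplus L, P.N L i : ℤ) : ℝ) := by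
    have hi : ∀ i, ∑ k, (Weights.vertex (P.Iplus L) m).w i k * (P.eps L i k : ℝ) =
        if i ∈ P.Iplus L then ((P.N L i : ℤ) : ℝ) else 0 := by
      intro i
      simp only [Weights.vertex, ite_mul, one_mul, zero_mul]
      by_cases hi : i ∈ P.Iplus L
      · simp only [hi, true_and, if_true, hm i]
        push_cast
        rw [← Finset.sum_filter]
        refine Finset.sum_congr ?_ fun _ _ => rfl
        ext k
        simp
      · simp [hi]
    rw [Finset.sum_congr rfl fun i _ => hi i, Finset.sum_ite_mem, Finset.univ_inter]
    push_cast
    rfl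
  rw [stab_eq, hsum]
  have hpos : 0 < E.degree - 2 * L.degree + ∑ i ∈ P.Iplus L, P.N L i := by
    rcases le_or_gt E.degree (2 * L.degree) with hd | hd
    · have := (h L hd).2
      omega
    · have : 0 ≤ ∑ i ∈ P.Iplus L, P.N L i :=
        Finset.sum_nonneg fun i hi => (Finset.mem_filter.1 hi).2.le
      omega
  exact_mod_cast hpos

variable {L}

/-- The numerical relation between two distinct line subbundles. -/
theorem exists_orders {L' : LineSubbundle E} (hne : L ≠ L') :
    ∃ e : Fin D.ν → ℕ, ((∑ i, e i : ℕ) : ℤ) ≤ E.degree - L.degree - L'.degree ∧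
      ∀ i k, P.interLength L i k + P.interLength L' i k ≤ k + e i := by
  obtain ⟨F⟩ := L.nonempty_frame
  obtain ⟨F'⟩ := L'.nonempty_frame
  obtain ⟨p, q, hpq, hq0, hq⟩ := LineSubbundle.exists_wedge hne F F'
  exact ⟨_, sum_ordAt_le D q (hq0 0) hq,
    fun i k => P.interLength_add_le F F' i (hpq _) (hq0 _) k⟩

theorem sum_eps_add (L L' : LineSubbundle E) (i : Fin D.ν) (k : Fin (D.mult i)) :
    ∑ j ∈ Finset.Iic k, ((P.eps L i j : ℝ) + (P.eps L' i j : ℝ)) =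
      ((2 * ((k.succ : ℕ) - (P.interLength L i k.succ + P.interLength L' i k.succ : ℕ)) : ℤ) :
        ℝ) := by
  have h := congrArg₂ (· + ·) (P.sum_eps L i k) (P.sum_eps L' i k)
  rw [Finset.sum_add_distrib]
  have h2 : (((∑ j ∈ Finset.Iic k, P.eps L i j) + ∑ j ∈ Finset.Iic k, P.eps L' i j : ℤ) : ℝ) =
      ((2 * ((k.succ : ℕ) - (P.interLength L i k.succ + P.interLength L' i k.succ : ℕ)) : ℤ) :
        ℝ) := by
    congr 1
    refine h.trans ?_
    rw [Fin.val_succ]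
    push_cast
    ring
  rw [← h2]
  push_cast
  rfl

theorem stab_add (w : Weights D) (L L' : LineSubbundle E) :
    P.stab w L + P.stab w L' = 2 * ((E.degree - L.degree - L'.degree : ℤ) : ℝ) +
      ∑ i, ∑ k, w.w i k * ((P.eps L i k : ℝ) + (P.eps L' i k : ℝ)) := by
  rw [stab_eq, stab_eq]
  simp only [mul_add, Finset.sum_add_distrib]
  push_cast
  ring

/-- Each t_i contributes at least −2e_i to the sum, and the orders e_i add up to at most deg E − deg
L − deg L'. -/
theorem stab_add_nonneg {L' : LineSubbundle E} (hne : L ≠ L') (w : Weights D) :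
    0 ≤ P.stab w L + P.stab w L' := by
  obtain ⟨e, he, hk⟩ := P.exists_orders hne
  rw [stab_add]
  have hi : ∀ i, -(2 * (e i : ℝ)) ≤
      ∑ k, w.w i k * ((P.eps L i k : ℝ) + (P.eps L' i k : ℝ)) := by
    intro i
    rw [neg_le, ← Finset.sum_neg_distrib]
    simp only [← mul_neg]
    refine sum_mul_le_of_partial_sums_le (w.nonneg i) (w.le_one i) (w.anti i) (by positivity)
      fun k => ?_
    rw [Finset.sum_neg_distrib, sum_eps_add, neg_le]
    have := hk i k.succ
    have h2 : -(2 * (e i : ℤ)) ≤ 2 * ((k.succ : ℕ) -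
      (P.interLength L i k.succ + P.interLength L' i k.succ : ℕ)) := by omega
    exact_mod_cast h2
  have hs := Finset.sum_le_sum fun i (_ : i ∈ Finset.univ) => hi i
  rw [Finset.sum_neg_distrib, ← Finset.mul_sum] at hs
  have he' : (∑ i, (e i : ℝ)) ≤ ((E.degree - L.degree - L'.degree : ℤ) : ℝ) := by
    exact_mod_cast he
  linarith

/-- Multiplied by M, the sum of the indices is an integer, so only its positivity is needed; if it
fails, the numerical equalities of `decomposable_of_eq` hold. -/
theorem Undecomposable.interior_le_stab_add {P : RefinedParabolic D E} (h : P.Undecomposable)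
    {L' : LineSubbundle E} (hne : L ≠ L') :
    1 / ((1 + ∑ i, D.mult i : ℕ) : ℝ) ≤
      P.stab (Weights.interior D) L + P.stab (Weights.interior D) L' := by
  obtain ⟨e, he, hk⟩ := P.exists_orders hne
  set M : ℕ := 1 + ∑ i, D.mult i with hM
  have hMpos : (0 : ℝ) < M := by rw [hM]; positivity
  let T : Fin D.ν → ℤ := fun i => ∑ k : Fin (D.mult i), 2 * (((k.succ : ℕ) : ℤ) -
    (P.interLength L i k.succ + P.interLength L' i k.succ : ℕ))
  have hT : ∀ i, ∑ k, (Weights.interior D).w i k * ((P.eps L i k : ℝ) + (P.eps L' i k : ℝ)) =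
      (T i : ℝ) / M := by
    intro i
    have h1 := sum_sub_mul_eq fun k => (P.eps L i k : ℝ) + (P.eps L' i k : ℝ)
    simp only [sum_eps_add] at h1
    have h2 : (T i : ℝ) = ∑ k : Fin (D.mult i), ((D.mult i : ℝ) - k) *
        ((P.eps L i k : ℝ) + (P.eps L' i k : ℝ)) := by
      rw [h1]
      simp only [T]
      rw [Int.cast_sum]
    rw [h2, Finset.sum_div]
    refine Finset.sum_congr rfl fun k _ => ?_
    change _ / (M : ℝ) * _ = _
    ring
  have hint : 1 ≤ 2 * (E.degree - L.degree - L'.degree) * M + ∑ i, T i := by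
    by_contra hlt
    have hTi : ∀ i, -(2 * (D.mult i : ℤ) * e i) ≤ T i := by
      intro i
      have : ∑ k : Fin (D.mult i), (-(2 * (e i : ℤ))) ≤ T i := by
        refine Finset.sum_le_sum fun k _ => ?_
        have := hk i k.succ
        omega
      rw [Finset.sum_const, Finset.card_univ, Fintype.card_fin, nsmul_eq_mul] at this
      linarith
    have hTi2 : ∀ i, -(2 * ((M : ℤ) - 1) * e i) ≤ T i := by
      intro i
      refine le_trans ?_ (hTi i)
      have h1 : D.mult i ≤ ∑ i, D.mult i :=
        Finset.single_le_sum (fun _ _ => Nat.zero_le _) (Finset.mem_univ i)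
      have h2 : (D.mult i : ℤ) ≤ (M : ℤ) - 1 := by omega
      have h3 : (0 : ℤ) ≤ e i := Int.natCast_nonneg _
      nlinarith
    have hs := Finset.sum_le_sum fun i (_ : i ∈ Finset.univ) => hTi2 i
    rw [Finset.sum_neg_distrib, ← Finset.mul_sum] at hs
    push_cast at he
    have he0 : (0 : ℤ) ≤ ∑ i, (e i : ℤ) := Finset.sum_nonneg fun _ _ => Int.natCast_nonneg _
    have hM1 : (0 : ℤ) ≤ (M : ℤ) - 1 := by rw [hM]; push_cast; simp; positivity
    -- With e this difference, Σ T_i ≥ −2(M − 1)e, so the integer is at least 2e; since e ≥ 0,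
    -- failure leaves only e = 0.
    have hdeg : E.degree - L.degree - L'.degree = 0 := by nlinarith
    rw [hdeg] at he hlt
    have hei : ∀ i, e i = 0 := by
      intro i
      have h1 : ∑ i, e i = 0 := by
        have : ((∑ i, e i : ℕ) : ℤ) ≤ 0 := by push_cast; exact he
        omega
      exact Finset.sum_eq_zero_iff.1 h1 i (Finset.mem_univ i)
    have hTnn : ∀ i, 0 ≤ T i := fun i => by simpa [hei i] using hTi i
    have hT0 : ∀ i, T i = 0 := by
      have h1 : ∑ i, T i = 0 :=
        le_antisymm (by linarith) (Finset.sum_nonneg fun i _ => hTnn i)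
      intro i
      exact (Finset.sum_eq_zero_iff_of_nonneg fun i _ => hTnn i).1 h1 i (Finset.mem_univ i)
    refine h (P.decomposable_of_eq hne (by omega) fun i k => ?_)
    refine Fin.cases ?_ (fun k => ?_) k
    · rw [interLength_zero, interLength_zero]
      rfl
    · have h1 := (Finset.sum_eq_zero_iff_of_nonneg (fun k _ => by
        have := hk i (Fin.succ k)
        rw [hei i] at this
        omega)).1 (hT0 i) k (Finset.mem_univ k)
      omega
  rw [stab_add, Finset.sum_congr rfl fun i _ => hT i, ← Finset.sum_div, div_le_iff₀ hMpos, add_mul,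
    div_mul_cancel₀ _ hMpos.ne']
  exact_mod_cast hint

/-- Two distinct subbundles cannot both violate stability for the interior weights, so only one L₀
has to be repaired, by moving towards weights that favour it. -/
theorem exists_stable {P : RefinedParabolic D E} (hu : P.Undecomposable) (ht : P.Tame) :
    ∃ w : Weights D, P.Stable w := by
  by_cases hst : P.Stable (Weights.interior D)
  · exact ⟨_, hst⟩
  obtain ⟨L₀, hL₀⟩ := not_forall.1 hst
  obtain ⟨w', hw'⟩ := ht.exists_weights_pos L₀
  set h₀ := P.stab (Weights.interior D) L₀ with hh₀
  set h₁ := P.stab w' L₀ with hh₁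
  set c : ℝ := 1 / ((1 + ∑ i, D.mult i : ℕ) : ℝ) with hc
  have hcpos : 0 < c := by rw [hc]; positivity
  have hneg : h₀ ≤ 0 := not_lt.1 hL₀
  have hden : 0 < h₁ - h₀ + c / 2 := by linarith
  -- Chosen so that L₀ gets index (1 − τ)c/2. Any other L has index sum with L₀ at least (1 − τ)c,
  -- hence itself keeps at least (1 − τ)c/2.
  set τ := (c / 2 - h₀) / (h₁ - h₀ + c / 2) with hτ
  have hτ0 : 0 ≤ τ := div_nonneg (by linarith) hden.le
  have hτ1 : τ < 1 := (div_lt_one hden).2 (by linarith)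
  have hτe : τ * (h₁ - h₀ + c / 2) = c / 2 - h₀ := div_mul_cancel₀ _ hden.ne'
  refine ⟨(Weights.interior D).mix w' τ hτ0 hτ1.le, fun L => ?_⟩
  have hval : (1 - τ) * h₀ + τ * h₁ = (1 - τ) * (c / 2) := by linarith
  have hpos : 0 < (1 - τ) * (c / 2) := mul_pos (by linarith) (by linarith)
  by_cases hL : L = L₀
  · rw [hL, stab_mix, ← hh₀, ← hh₁, hval]
    exact hpos
  · have h2 := hu.interior_le_stab_add hL
    have h3 := P.stab_add_nonneg hL w'
    rw [← hh₀, ← hc] at h2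
    rw [← hh₁] at h3
    rw [stab_mix]
    have h4 := mul_le_mul_of_nonneg_left h2 (show 0 ≤ 1 - τ by linarith)
    have h5 := mul_nonneg hτ0 h3
    linarith

end RefinedParabolic

/-- The degree of a direct sum of two line bundles. -/
theorem LineSubbundle.degree_eq_add {L L' : LineSubbundle E}
    (h : ∀ j, Disjoint (L.sec j) (L'.sec j) ∧ L.sec j ⊔ L'.sec j = E.sec j) :
    L ≠ L' ∧ E.degree = L.degree + L'.degree := by
  obtain ⟨F⟩ := L.nonempty_frame
  obtain ⟨F'⟩ := L'.nonempty_frame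
  have hne : L ≠ L' := by
    rintro rfl
    exact F.u_ne_zero 0 (Submodule.disjoint_def.1 (h 0).1 _ (F.u_mem_line 0) (F.u_mem_line 0))
  refine ⟨hne, ?_⟩
  obtain ⟨p, q, hpq, hq0, hq⟩ := exists_wedge hne F F'
  -- Splitting `v` along L ⊕ L' and comparing `v`-coefficients inverts `q`, so this section of 𝒪(e)
  -- has no zeros and e = 0.
  have hunit : ∀ j, IsUnit (q j) := by
    intro j
    have hv := F.v_mem j
    rw [← (h j).2] at hv
    obtain ⟨y, hy, z, hz, hyz⟩ := Submodule.mem_sup.1 hv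
    obtain ⟨a, rfl⟩ := (F.mem_line j y).1 hy
    obtain ⟨b, rfl⟩ := (F'.mem_line j z).1 hz
    rw [hpq j, smul_add, smul_smul, smul_smul, ← add_assoc, ← add_smul] at hyz
    have h1 : (a + b * p j) • F.u j + (b * q j) • F.v j =
        (0 : ChartRing j) • F.u j + (1 : ChartRing j) • F.v j := by
      rw [hyz, zero_smul, one_smul, zero_add]
    exact IsUnit.of_mul_eq_one_right _ (F.chart_coords_eq j h1).2
  have h0 : Polynomial.natDegree (q 0) = 0 :=
    Polynomial.natDegree_eq_zero_of_isUnit (p := (q 0 : Polynomial ℂ)) (hunit 0)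
  have h1 : Polynomial.natDegree (q 1) = 0 :=
    Polynomial.natDegree_eq_zero_of_isUnit (p := (q 1 : Polynomial ℂ)) (hunit 1)
  have h2 := Polynomial.natTrailingDegree_le_natDegree (q 1)
  have h3 := natDegree_add_natTrailingDegree_eq (g₀ := q 0) (g₁ := q 1) (hq0 0) hq
  omega

/-- For a decomposition exactly one summand jumps at each step, so the signs are opposite and the
two indices add up to zero. -/
theorem RefinedParabolic.Stable.undecomposable {P : RefinedParabolic D E} {w : Weights D}
    (h : P.Stable w) : P.Undecomposable := by
  rintro ⟨L₁, L₂, hsec, hl⟩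
  obtain ⟨hne, hdeg⟩ := LineSubbundle.degree_eq_add hsec
  have hlen : ∀ i k, P.interLength L₁ i k + P.interLength L₂ i k = k := by
    intro i k
    have h1 := length_sup_add_inf (P.l i k ⊓ L₁.restr (D.pt i) (D.mult i))
      (P.l i k ⊓ L₂.restr (D.pt i) (D.mult i))
    rw [disjoint_iff.1 (hl i k).1, ← (hl i k).2, Module.length_bot, add_zero, P.length_eq,
      ← P.coe_interLength, ← P.coe_interLength] at h1
    exact_mod_cast h1.symm
  have h1 := P.stab_add w L₁ L₂
  have h2 : ∀ i, ∑ k, w.w i k * ((P.eps L₁ i k : ℝ) + (P.eps L₂ i k : ℝ)) = 0 := by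
    intro i
    refine Finset.sum_eq_zero fun k _ => ?_
    have h3 := P.interLength_succ L₁ i k
    have h4 := P.interLength_succ L₂ i k
    have h5 := hlen i k.succ
    have h6 := hlen i k.castSucc
    rw [Fin.val_succ] at h5
    rw [Fin.val_castSucc] at h6
    have h7 : P.eps L₁ i k + P.eps L₂ i k = 0 := by
      rw [P.eps_eq, P.eps_eq]
      omega
    have h8 : (P.eps L₁ i k : ℝ) + (P.eps L₂ i k : ℝ) = 0 := by exact_mod_cast h7
    rw [h8, mul_zero]
  rw [Finset.sum_eq_zero fun i _ => h2 i, hdeg] at h1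
  have h3 := h L₁
  have h4 := h L₂
  simp at h1
  linarith

theorem RefinedParabolic.undecomposable_and_tame_iff (P : RefinedParabolic D E) :
    (P.Undecomposable ∧ P.Tame) ↔ ∃ w : Weights D, P.Stable w :=
  ⟨fun h => RefinedParabolic.exists_stable h.1 h.2, fun ⟨_, h⟩ => ⟨h.undecomposable, h.tame⟩⟩

/-! ### Endomorphisms -/

/-- The endomorphism of `E|_{n[t]}` induced by an endomorphism of `E`. -/
noncomputable def RankTwoBundle.endoRestr (E : RankTwoBundle V) (φ : V →ₗ[K] V)
    (h : ∀ j, ∀ s ∈ E.sec j, φ s ∈ E.sec j) (t : OnePoint ℂ) (n : ℕ) :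
    E.Restr t n →ₗ[ThickRing t n] E.Restr t n where
  toFun := Submodule.mapQ (thickIdeal t n • ⊤) (thickIdeal t n • ⊤)
    ((φ.restrictScalars (ChartRing (chartIdx t))).restrict (h (chartIdx t)))
    (by
      rw [← Submodule.map_le_iff_le_comap, Submodule.map_smul'']
      exact Submodule.smul_mono le_rfl le_top)
  map_add' := map_add _
  map_smul' a x := by
    obtain ⟨a, rfl⟩ := thick_mk_surjective t n a
    obtain ⟨s, rfl⟩ := E.res_surjective t n x
    rw [← E.res_smul]
    exact (congrArg (E.res t n) (map_smul
      ((φ.restrictScalars (ChartRing (chartIdx t))).restrict (h (chartIdx t))) a s)).trans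
      (E.res_smul t n a _)

theorem RankTwoBundle.exists_lineSubbundle (E : RankTwoBundle V) : Nonempty (LineSubbundle E) := by
  have : Nontrivial V := Module.nontrivial_of_finrank_pos (R := K) (by rw [E.finrank_eq]; simp)
  obtain ⟨x, hx⟩ := exists_ne (0 : V)
  exact ⟨E.lineSubbundle (Submodule.span K {x}) (finrank_span_singleton hx)⟩

namespace LineSubbundle.Frame

variable {L : LineSubbundle E} (F : L.Frame)

/-- The basis of the generic fibre given by a frame over the chart `j`. -/
noncomputable def basis (j : Fin 2) : Basis (Fin 2) K V :=
  basisOfLinearIndependentOfCardEqFinrank (F.indep j) (by rw [E.finrank_eq]; simp)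

theorem basis_zero (j : Fin 2) : F.basis j 0 = F.u j := by simp [basis]

theorem basis_one (j : Fin 2) : F.basis j 1 = F.v j := by simp [basis]

theorem toMatrix_eq (j : Fin 2) (φ : V →ₗ[K] V) {a b c d : K}
    (hu : φ (F.u j) = a • F.u j + b • F.v j) (hv : φ (F.v j) = c • F.u j + d • F.v j) :
    LinearMap.toMatrix (F.basis j) (F.basis j) φ = !![a, c; b, d] := by
  ext x y
  have hrep : ∀ a b : K, (F.basis j).repr (a • F.u j + b • F.v j) =
      a • Finsupp.single 0 1 + b • Finsupp.single 1 1 := by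
    intro a b
    rw [← F.basis_zero, ← F.basis_one, map_add, map_smul, map_smul, Basis.repr_self,
      Basis.repr_self]
  rw [LinearMap.toMatrix_apply]
  fin_cases y
  · simp only [Fin.zero_eta, F.basis_zero, hu, hrep]
    fin_cases x <;> simp
  · simp only [Fin.mk_one, F.basis_one, hv, hrep]
    fin_cases x <;> simp

theorem exists_trace_det (F : L.Frame) (j : Fin 2) {φ : V →ₗ[K] V} (h : ∀ s ∈ E.sec j, φ s ∈ E.sec j) :
    ∃ τ δ : ChartRing j, LinearMap.trace K V φ = ChartRing.toK j τ ∧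
      LinearMap.det φ = ChartRing.toK j δ ∧ ∀ c : K,
        LinearMap.det (φ - c • LinearMap.id) =
          c * c - ChartRing.toK j τ * c + ChartRing.toK j δ := by
  obtain ⟨a, b, hu⟩ := (F.mem_sec j _).1 (h _ (F.u_mem j))
  obtain ⟨c, d, hv⟩ := (F.mem_sec j _).1 (h _ (F.v_mem j))
  refine ⟨a + d, a * d - c * b, ?_, ?_, fun k => ?_⟩
  · rw [LinearMap.trace_eq_matrix_trace K (F.basis j), F.toMatrix_eq j φ hu hv,
      Matrix.trace_fin_two_of, map_add]
    rfl
  · rw [← LinearMap.det_toMatrix (F.basis j), F.toMatrix_eq j φ hu hv, Matrix.det_fin_two_of,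
      map_sub, map_mul, map_mul]
    rfl
  · have hu' : (φ - k • LinearMap.id : V →ₗ[K] V) (F.u j) =
        (ChartRing.toK j a - k) • F.u j + ChartRing.toK j b • F.v j := by
      rw [LinearMap.sub_apply, hu, ChartRing.smul_def, ChartRing.smul_def, LinearMap.smul_apply,
        LinearMap.id_apply, sub_smul]
      abel
    have hv' : (φ - k • LinearMap.id : V →ₗ[K] V) (F.v j) =
        ChartRing.toK j c • F.u j + (ChartRing.toK j d - k) • F.v j := by
      rw [LinearMap.sub_apply, hv, ChartRing.smul_def, ChartRing.smul_def, LinearMap.smul_apply,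
        LinearMap.id_apply, sub_smul]
      abel
    rw [← LinearMap.det_toMatrix (F.basis j), F.toMatrix_eq j _ hu' hv', Matrix.det_fin_two_of,
      map_sub, map_mul, map_mul, map_add]
    ring

theorem ext_linearMap (j : Fin 2) {φ ψ : V →ₗ[K] V} (hu : φ (F.u j) = ψ (F.u j))
    (hv : φ (F.v j) = ψ (F.v j)) : φ = ψ := by
  refine (F.basis j).ext fun x => ?_
  fin_cases x
  · simpa [F.basis_zero] using hu
  · simpa [F.basis_one] using hv

end LineSubbundle.Frame

/-- Every endomorphism of `E` has an eigenvalue in `ℂ`. -/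
theorem RankTwoBundle.exists_eigenvalue (E : RankTwoBundle V) {φ : V →ₗ[K] V}
    (h : ∀ j, ∀ s ∈ E.sec j, φ s ∈ E.sec j) :
    ∃ c : ℂ, LinearMap.det (φ - (RatFunc.C c : K) • LinearMap.id) = 0 := by
  obtain ⟨L⟩ := E.exists_lineSubbundle
  obtain ⟨F⟩ := L.nonempty_frame
  obtain ⟨τ₀, δ₀, hτ₀, hδ₀, hdet⟩ := F.exists_trace_det 0 (h 0)
  obtain ⟨τ₁, δ₁, hτ₁, hδ₁, -⟩ := F.exists_trace_det 1 (h 1)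
  -- Trace and determinant are regular on both charts, hence constants; the eigenvalue is then a
  -- root of a quadratic over ℂ.
  obtain ⟨τ, hτ, -⟩ := exists_C_of_section_zero (g₀ := τ₀) (g₁ := τ₁) (hτ₁.symm.trans hτ₀)
  obtain ⟨δ, hδ, -⟩ := exists_C_of_section_zero (g₀ := δ₀) (g₁ := δ₁) (hδ₁.symm.trans hδ₀)
  obtain ⟨r, hr⟩ := IsAlgClosed.exists_eq_mul_self (τ * τ - 4 * δ)
  refine ⟨(τ + r) / 2, ?_⟩
  have hτ' : ChartRing.toK 0 τ₀ = RatFunc.C τ := (congrArg (ChartRing.toK 0) hτ).trans (toK_C 0 τ)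
  have hδ' : ChartRing.toK 0 δ₀ = RatFunc.C δ := (congrArg (ChartRing.toK 0) hδ).trans (toK_C 0 δ)
  rw [hdet, hτ', hδ', ← map_mul, ← map_mul, ← map_sub, ← map_add, ← map_zero RatFunc.C]
  congr 1
  linear_combination (-1 / 4 : ℂ) * hr

/-! ### Stable implies simple, and simple implies undecomposable -/

namespace Parabolic

variable {P : Parabolic D E}

theorem toRefined_l_last (P : Parabolic D E) (i : Fin D.ν) :
    P.toRefined.l i (Fin.last _) = P.l i := by
  ext x
  simp [toRefined]

theorem IsEndo.sub_smul_id {φ : V →ₗ[K] V} (h : P.IsEndo φ) (c : ℂ) :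
    P.IsEndo (φ - (RatFunc.C c : K) • LinearMap.id) := by
  obtain ⟨h, hl⟩ := h
  have hval : ∀ j (s : V), (φ - (RatFunc.C c : K) • LinearMap.id : V →ₗ[K] V) s =
      φ s - ChartRing.C j c • s := by
    intro j s
    rw [ChartRing.smul_def, ChartRing.toK_C]
    rfl
  refine ⟨fun j s hs => ?_, fun i s hs => ?_⟩
  · rw [hval j]
    exact sub_mem (h j s hs) ((E.sec j).smul_mem _ hs)
  · have h1 : (⟨(φ - (RatFunc.C c : K) • LinearMap.id : V →ₗ[K] V) s, by
        rw [hval (chartIdx (D.pt i))]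
        exact sub_mem (h _ s s.2) ((E.sec _).smul_mem _ s.2)⟩ : E.sec (chartIdx (D.pt i))) =
        ⟨φ s, h _ s s.2⟩ - ChartRing.C (chartIdx (D.pt i)) c • s :=
      Subtype.ext (hval (chartIdx (D.pt i)) s)
    rw [h1, map_sub, E.res_smul]
    exact sub_mem (hl i s hs) (Submodule.smul_mem _ _ hs)

/-- A nonzero singular endomorphism yields two line subbundles whose stability indices do not have
a positive sum. -/
theorem exists_stab_add_nonpos {ψ : V →ₗ[K] V} (h : P.IsEndo ψ) (h0 : ψ ≠ 0)
    (hdet : LinearMap.det ψ = 0) (w : Weights D) :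
    ∃ L₁ L₂ : LineSubbundle E, P.toRefined.stab w L₁ + P.toRefined.stab w L₂ ≤ 0 := by
  obtain ⟨hE, hl⟩ := h
  have hfin : FiniteDimensional K V := Module.finite_of_finrank_pos (by rw [E.finrank_eq]; simp)
  have hker : finrank K (LinearMap.ker ψ) = 1 ∧ finrank K (LinearMap.range ψ) = 1 := by
    have h1 := LinearMap.finrank_range_add_finrank_ker ψ
    have h2 : finrank K (LinearMap.ker ψ) ≠ 0 := fun hz =>
      (LinearMap.bot_lt_ker_of_det_eq_zero hdet).ne' (Submodule.finrank_eq_zero.1 hz)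
    have h3 : finrank K (LinearMap.range ψ) ≠ 0 := fun hz =>
      h0 (LinearMap.range_eq_bot.1 (Submodule.finrank_eq_zero.1 hz))
    rw [E.finrank_eq] at h1
    omega
  -- Kernel and saturated image; `ψ` induces a map E/L₁ → L₂, that is, a nonzero section `g` of
  -- 𝒪(deg L₁ + deg L₂ − deg E).
  set L₁ := E.lineSubbundle _ hker.1 with hL₁
  set L₂ := E.lineSubbundle _ hker.2 with hL₂
  obtain ⟨F₁⟩ := L₁.nonempty_frame
  obtain ⟨F₂⟩ := L₂.nonempty_frame
  have hu : ∀ j, ψ (F₁.u j) = 0 := fun j => (F₁.u_mem_line j).2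
  have hv : ∀ j, ∃ g : ChartRing j, ψ (F₁.v j) = g • F₂.u j := fun j =>
    (F₂.mem_line j _).1 ⟨hE j _ (F₁.v_mem j), ⟨_, rfl⟩⟩
  choose g hg using hv
  have hg0 : ∀ j, g j ≠ 0 := fun j hz => h0 (F₁.ext_linearMap j (by rw [hu, LinearMap.zero_apply])
    (by rw [hg, hz, zero_smul, LinearMap.zero_apply]))
  have hrel : ChartRing.toK 1 (g 1) =
      RatFunc.X ^ (-(L₁.degree + L₂.degree - E.degree)) * ChartRing.toK 0 (g 0) := by
    have h1 := hg 1
    rw [F₁.v_one, F₂.u_one, map_add, map_smul, map_smul, hu, smul_zero, zero_add, hg 0,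
      ChartRing.smul_def, ChartRing.smul_def, smul_smul, smul_smul] at h1
    have h2 := smul_left_injective K (F₂.u_ne_zero 0) h1
    have h3 : (RatFunc.X : K) ^ L₂.degree ≠ 0 := zpow_ne_zero _ ratX_ne_zero
    apply mul_right_cancel₀ h3
    rw [← h2, mul_right_comm, ← zpow_add₀ ratX_ne_zero]
    congr 2
    ring
  refine ⟨L₁, L₂, ?_⟩
  -- Additivity of length for `ψ` on l_{i,k}: the image lies in l_{i,k} ∩ L₂, and the kernel exceeds
  -- its part in L₁ by at most the order of `g`. This reverses the inequality of
  -- `interLength_add_le`.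
  have hlen : ∀ i (k : Fin (D.mult i + 1)), (k : ℕ) ≤ P.toRefined.interLength L₁ i k + P.toRefined.interLength L₂ i k +
      ordAt (D.pt i) (g (chartIdx (D.pt i))) := by
    intro i k
    let f := E.endoRestr ψ hE (D.pt i) (D.mult i)
    have hf : ∀ a b : ThickRing (D.pt i) (D.mult i), f (a • F₁.uRes (D.pt i) (D.mult i) + b • F₁.vRes (D.pt i) (D.mult i)) =
        (b * ThickRing.mk (D.pt i) (D.mult i) (g (chartIdx (D.pt i)))) •
           F₂.uRes (D.pt i) (D.mult i) := by
      intro a b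
      rw [map_add, map_smul, map_smul]
      have h1 : f (F₁.uRes (D.pt i) (D.mult i)) = 0 := by
        have : (⟨ψ (F₁.u (chartIdx (D.pt i))), hE _ _ (F₁.u_mem _)⟩ : E.sec (chartIdx (D.pt i)))
          = 0 := Subtype.ext (hu _)
        exact (congrArg (E.res _ _) this).trans (map_zero _)
      have h2 : f (F₁.vRes (D.pt i) (D.mult i)) = ThickRing.mk (D.pt i) (D.mult i) (g (chartIdx (D.pt i))) • F₂.uRes (D.pt i) (D.mult i) := by
        have : (⟨ψ (F₁.v (chartIdx (D.pt i))), hE _ _ (F₁.v_mem _)⟩ : E.sec (chartIdx (D.pt i)))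
          = g (chartIdx (D.pt i)) • ⟨F₂.u _, F₂.u_mem _⟩ := Subtype.ext (hg _)
        exact (congrArg (E.res _ _) this).trans (E.res_smul _ _ _ _)
      rw [h1, h2, smul_zero, zero_add, smul_smul]
    have hPl : ∀ x ∈ P.l i, f x ∈ P.l i := by
      intro x hx
      obtain ⟨s, rfl⟩ := E.res_surjective _ _ x
      exact hl i s hx
    have hmap : (P.toRefined.l i k).map f ≤
        P.toRefined.l i k ⊓ L₂.restr (D.pt i) (D.mult i) := by
      rintro _ ⟨x, hx, rfl⟩
      refine ⟨?_, ?_⟩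
      -- Every l_{i,k} is a multiple of l_i by a power of the uniformizer, so preserving l_i is
      -- enough.
      · obtain ⟨y, hy, rfl⟩ := hx
        exact ⟨f y, hPl y hy, (map_smul f _ _).symm⟩
      · obtain ⟨a, b, rfl⟩ := F₁.exists_coords _ _ x
        exact (F₂.mem_restr_iff _ _ _).2 ⟨_, hf a b⟩
    have hkerf : Module.length (ThickRing (D.pt i) (D.mult i))
        ((P.toRefined.l i k ⊓ LinearMap.ker f).map (L₁.restr (D.pt i) (D.mult i)).mkQ) ≤
        ordAt (D.pt i) (g (chartIdx (D.pt i))) := by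
      refine length_le_of_forall_exists_smul _ _ _
        ((L₁.restr (D.pt i) (D.mult i)).mkQ (F₁.vRes _ _)) _ ?_
      rintro _ ⟨x, ⟨-, hx⟩, rfl⟩
      obtain ⟨a, b, rfl⟩ := F₁.exists_coords _ _ x
      refine ⟨b, ?_, ?_⟩
      · have : a • F₁.uRes (D.pt i) (D.mult i) ∈ L₁.restr (D.pt i) (D.mult i) :=
          (F₁.mem_restr_iff _ _ _).2 ⟨a, rfl⟩
        have hz : (L₁.restr (D.pt i) (D.mult i)).mkQ (a • F₁.uRes (D.pt i) (D.mult i)) = 0 :=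
          (Submodule.Quotient.mk_eq_zero _).2 this
        rw [map_add, hz, zero_add, map_smul]
      · have hx' : f (a • F₁.uRes _ _ + b • F₁.vRes _ _) = 0 := hx
        rw [hf] at hx'
        refine thickUnif_pow_ordAt_mul_eq_zero _ _ (hg0 _)
          (F₂.coords_eq_zero _ _ (b := 0) ?_).1
        rw [hx', zero_smul, add_zero]
    have h1 := length_le_map_add f (P.toRefined.l i k)
    have h2 := length_le_map_add (L₁.restr (D.pt i) (D.mult i)).mkQ
      (P.toRefined.l i k ⊓ LinearMap.ker f)
    rw [Submodule.ker_mkQ] at h2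
    have h3 : Module.length (ThickRing (D.pt i) (D.mult i))
        (P.toRefined.l i k ⊓ LinearMap.ker f ⊓ L₁.restr (D.pt i) (D.mult i) : Submodule _ _) ≤
        P.toRefined.interLength L₁ i k := by
      rw [P.toRefined.coe_interLength]
      exact length_mono (inf_le_inf_right _ inf_le_left)
    have h4 := length_mono hmap
    rw [← P.toRefined.coe_interLength] at h4
    rw [P.toRefined.length_eq, h2] at h1
    have h5 := h1.le.trans (add_le_add (add_le_add h3 hkerf) h4)
    have h6 : (k : ℕ) ≤ P.toRefined.interLength L₁ i k +
      ordAt (D.pt i) (g (chartIdx (D.pt i))) + P.toRefined.interLength L₂ i k := by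
      exact_mod_cast h5
    omega
  have hsum := sum_ordAt_le D g (hg0 0) hrel
  rw [RefinedParabolic.stab_add]
  have hi : ∀ i, ∑ k, w.w i k * ((P.toRefined.eps L₁ i k : ℝ) + (P.toRefined.eps L₂ i k : ℝ)) ≤
      2 * (ordAt (D.pt i) (g (chartIdx (D.pt i))) : ℝ) := by
    intro i
    refine sum_mul_le_of_partial_sums_le (w.nonneg i) (w.le_one i) (w.anti i) (by positivity)
      fun k => ?_
    rw [RefinedParabolic.sum_eps_add]
    have h1 := hlen i k.succ
    have h2 : (2 * ((k.succ : ℕ) - (P.toRefined.interLength L₁ i k.succ +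
      P.toRefined.interLength L₂ i k.succ : ℕ)) : ℤ) ≤
        2 * (ordAt (D.pt i) (g (chartIdx (D.pt i))) : ℤ) := by omega
    exact_mod_cast h2
  have hs := Finset.sum_le_sum fun i (_ : i ∈ Finset.univ) => hi i
  rw [← Finset.mul_sum] at hs
  have hsum' : (∑ i, (ordAt (D.pt i) (g (chartIdx (D.pt i))) : ℝ)) ≤
      ((L₁.degree + L₂.degree - E.degree : ℤ) : ℝ) := by exact_mod_cast hsum
  push_cast at hsum' ⊢
  linarith

theorem simple_of_stable {w : Weights D} (h : P.toRefined.Stable w) : P.Simple := by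
  intro φ hφ
  obtain ⟨c, hc⟩ := E.exists_eigenvalue hφ.choose
  refine ⟨c, fun v => ?_⟩
  by_cases h0 : φ - (RatFunc.C c : K) • LinearMap.id = 0
  · have := LinearMap.congr_fun (sub_eq_zero.1 h0) v
    simpa using this
  · obtain ⟨L₁, L₂, hL⟩ := exists_stab_add_nonpos (hφ.sub_smul_id c) h0 hc w
    have h1 := h L₁
    have h2 := h L₂
    linarith

/-- A simple parabolic bundle is undecomposable. -/
theorem Simple.undecomposable (h : P.Simple) : P.toRefined.Undecomposable := by
  rintro ⟨L₁, L₂, hsec, hl⟩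
  obtain ⟨hne, hdeg⟩ := LineSubbundle.degree_eq_add hsec
  obtain ⟨F₁⟩ := L₁.nonempty_frame
  obtain ⟨F₂⟩ := L₂.nonempty_frame
  have hcompl : IsCompl L₁.genericFiber L₂.genericFiber := by
    constructor
    · rw [Submodule.disjoint_def]
      intro x h1 h2
      obtain ⟨b, hb, hbx⟩ := E.exists_smul_mem_sec (w := x) (by rw [E.genericFiber_eq]; trivial)
      have h3 := Submodule.disjoint_def.1 (hsec 0).1 _
        ((L₁.mem_sec_iff 0 _).2 ⟨hbx, L₁.genericFiber.smul_mem _ h1⟩)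
        ((L₂.mem_sec_iff 0 _).2 ⟨hbx, L₂.genericFiber.smul_mem _ h2⟩)
      rw [ChartRing.smul_def] at h3
      exact (smul_eq_zero.1 h3).resolve_left (toK_ne_zero hb)
    · rw [codisjoint_iff, ← top_le_iff, ← E.genericFiber_eq]
      refine Submodule.span_le.2 fun s hs => ?_
      rw [← (hsec 0).2] at hs
      obtain ⟨y, hy, z, hz, rfl⟩ := Submodule.mem_sup.1 hs
      exact add_mem (Submodule.mem_sup_left ((L₁.mem_sec_iff 0 y).1 hy).2)
        (Submodule.mem_sup_right ((L₂.mem_sec_iff 0 z).1 hz).2)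
  -- The projection onto L₁ along L₂ will be a nonscalar endomorphism.
  obtain ⟨π, hπ₁, hπ₂⟩ : ∃ π : V →ₗ[K] V, (∀ x ∈ L₁.genericFiber, π x = x) ∧
      ∀ x ∈ L₂.genericFiber, π x = 0 := by
    refine ⟨LinearMap.ofIsCompl hcompl L₁.genericFiber.subtype 0, fun x hx => ?_, fun x hx => ?_⟩
    · exact LinearMap.ofIsCompl_apply_left hcompl ⟨x, hx⟩
    · exact LinearMap.ofIsCompl_apply_right hcompl ⟨x, hx⟩
  have hsplit : ∀ j, ∀ s ∈ E.sec j, ∃ y ∈ L₁.sec j, ∃ z ∈ L₂.sec j, s = y + z ∧ π s = y := by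
    intro j s hs
    rw [← (hsec j).2] at hs
    obtain ⟨y, hy, z, hz, rfl⟩ := Submodule.mem_sup.1 hs
    refine ⟨y, hy, z, hz, rfl, ?_⟩
    rw [map_add, hπ₁ _ ((L₁.mem_sec_iff j y).1 hy).2, hπ₂ _ ((L₂.mem_sec_iff j z).1 hz).2, add_zero]
  have hE : ∀ j, ∀ s ∈ E.sec j, π s ∈ E.sec j := by
    intro j s hs
    obtain ⟨y, hy, z, hz, -, h1⟩ := hsplit j s hs
    rw [h1]
    exact L₁.le j hy
  have hendo : P.IsEndo π := by
    refine ⟨hE, fun i s hs => ?_⟩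
    obtain ⟨y, hy, z, hz, hyz, h1⟩ := hsplit _ s s.2
    have hs' := hs
    rw [← P.toRefined_l_last i, (hl i (Fin.last _)).2] at hs'
    obtain ⟨a, ⟨haP, haL⟩, b, ⟨hbP, hbL⟩, hab⟩ := Submodule.mem_sup.1 hs'
    have hs2 : s = ⟨y, L₁.le _ hy⟩ + ⟨z, L₂.le _ hz⟩ := Subtype.ext hyz
    have hyr : E.res (D.pt i) (D.mult i) ⟨y, L₁.le _ hy⟩ ∈ L₁.restr (D.pt i) (D.mult i) :=
      Submodule.subset_span ⟨_, hy, rfl⟩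
    have hzr : E.res (D.pt i) (D.mult i) ⟨z, L₂.le _ hz⟩ ∈ L₂.restr (D.pt i) (D.mult i) :=
      Submodule.subset_span ⟨_, hz, rfl⟩
    -- The splitting of the section and the splitting inside l_i agree, because the fibres of L₁ and
    -- L₂ are independent.
    have hmem : E.res (D.pt i) (D.mult i) ⟨y, L₁.le _ hy⟩ - a ∈
        L₁.restr (D.pt i) (D.mult i) ⊓ L₂.restr (D.pt i) (D.mult i) := by
      refine ⟨sub_mem hyr haL, ?_⟩
      have : E.res (D.pt i) (D.mult i) ⟨y, L₁.le _ hy⟩ - a =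
          b - E.res (D.pt i) (D.mult i) ⟨z, L₂.le _ hz⟩ := by
        rw [sub_eq_sub_iff_add_eq_add, add_comm b, hab, ← map_add, ← hs2]
      rw [this]
      exact sub_mem hbL hzr
    rw [LineSubbundle.restr_inf_eq_bot hne hdeg D i (D.mult i), Submodule.mem_bot,
      sub_eq_zero] at hmem
    have h2 : (⟨π s, hE _ s s.2⟩ : E.sec (chartIdx (D.pt i))) = ⟨y, L₁.le _ hy⟩ := Subtype.ext h1
    rw [h2, hmem, ← P.toRefined_l_last i]
    exact haP
  obtain ⟨c, hc⟩ := h π hendo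
  have h1 := hc (F₁.u 0)
  have h2 := hc (F₂.u 0)
  rw [hπ₁ _ ((L₁.mem_sec_iff 0 _).1 (F₁.u_mem_line 0)).2] at h1
  rw [hπ₂ _ ((L₂.mem_sec_iff 0 _).1 (F₂.u_mem_line 0)).2] at h2
  have h3 := (smul_eq_zero.1 h2.symm).resolve_right (F₂.u_ne_zero 0)
  rw [h3, zero_smul] at h1
  exact F₁.u_ne_zero 0 h1

end Parabolic

/-! ### Simple implies tame -/

theorem thickUnif_pow_pred_ne_zero (t : OnePoint ℂ) {n : ℕ} (hn : 0 < n) :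
    thickUnif t n ^ (n - 1) ≠ 0 := by
  rw [thickUnif, ← map_pow, Ne, thick_mk_eq_zero_iff]
  rintro ⟨c, hc⟩
  have h1 : unif t ^ (n - 1) * 1 = unif t ^ (n - 1) * (unif t * c) := by
    rw [mul_one, ← mul_assoc, ← pow_succ, Nat.sub_add_cancel hn, ← hc]
  have h2 := mul_left_cancel₀ (pow_ne_zero _ (unif_ne_zero t)) h1
  have hu : IsUnit (unif t) := IsUnit.of_mul_eq_one _ h2.symm
  rw [unif_eq] at hu
  exact Polynomial.not_isUnit_X_sub_C (center t) hu

theorem le_length_span_singleton (t : OnePoint ℂ) (n : ℕ) {M : Type*} [AddCommGroup M]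
    [Module (ThickRing t n) M] (o : ℕ) (z : M) (hz : thickUnif t n ^ o • z ≠ 0) :
    ((o + 1 : ℕ) : ℕ∞) ≤
      Module.length (ThickRing t n) (Submodule.span (ThickRing t n) {z}) := by
  induction o generalizing z with
  | zero =>
    rw [pow_zero, one_smul] at hz
    have : Nontrivial (Submodule.span (ThickRing t n) {z}) :=
      ⟨⟨⟨z, Submodule.mem_span_singleton_self z⟩, 0, fun h => hz (congrArg Subtype.val h)⟩⟩
    exact Order.one_le_iff_pos.2 Module.length_pos
  | succ o ih =>
    have hle : Submodule.span (ThickRing t n) {thickUnif t n • z} ≤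
        Submodule.span (ThickRing t n) {z} :=
      Submodule.span_le.2 (Set.singleton_subset_iff.2
        (Submodule.smul_mem _ _ (Submodule.mem_span_singleton_self z)))
    rw [length_add_quotient hle, Nat.cast_add, Nat.cast_one]
    refine add_le_add (ih _ (by rwa [smul_smul, ← pow_succ])) ?_
    refine Order.one_le_iff_pos.2 (Module.length_pos_iff.2 ?_)
    refine ⟨⟨Submodule.Quotient.mk ⟨z, Submodule.mem_span_singleton_self z⟩, 0, fun h => ?_⟩⟩
    have hm : z ∈ Submodule.span (ThickRing t n) {thickUnif t n • z} :=
      (Submodule.Quotient.mk_eq_zero ((Submodule.span (ThickRing t n)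
        {thickUnif t n • z}).submoduleOf (Submodule.span (ThickRing t n) {z}))).1 h
    obtain ⟨a, ha⟩ := Submodule.mem_span_singleton.1 hm
    -- From z = aϖz it follows that z = (aϖ)^n z = 0, as ϖ is nilpotent. So the chain is strict.
    have hpow : ∀ m : ℕ, (a * thickUnif t n) ^ m • z = z := by
      intro m
      induction m with
      | zero => rw [pow_zero, one_smul]
      | succ m ih => rw [pow_succ, mul_smul, mul_smul, ha, ih]
    have h1 := hpow n
    rw [mul_pow, thickUnif_pow, mul_zero, zero_smul] at h1
    exact hz (by rw [← h1, smul_zero])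

namespace Parabolic

variable {P : Parabolic D E}

/-- A single basis vector already spans length n_i, the full length of l_i, so the free module l_i
has rank one. -/
theorem exists_generator (P : Parabolic D E) (i : Fin D.ν) :
    ∃ z, P.l i = Submodule.span (ThickRing (D.pt i) (D.mult i)) {z} ∧
      thickUnif (D.pt i) (D.mult i) ^ (D.mult i - 1) • z ≠ 0 := by
  have := P.free i
  have hnt : Nontrivial (P.l i) := by
    rw [← Module.length_pos_iff (R := ThickRing (D.pt i) (D.mult i)), P.length_eq]
    exact_mod_cast D.mult_pos i
  let b := Module.Free.chooseBasis (ThickRing (D.pt i) (D.mult i)) (P.l i)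
  obtain ⟨x⟩ : Nonempty (Module.Free.ChooseBasisIndex (ThickRing (D.pt i) (D.mult i)) (P.l i)) :=
    b.index_nonempty
  have hz : thickUnif (D.pt i) (D.mult i) ^ (D.mult i - 1) • (b x : E.Restr (D.pt i) (D.mult i)) ≠ 0 := by
    intro h0
    have h1 : thickUnif (D.pt i) (D.mult i) ^ (D.mult i - 1) • b x = 0 := Subtype.ext h0
    have h2 := congrArg (fun y => b.repr y x) h1
    simp only [map_smul, Basis.repr_self, Finsupp.smul_apply, Finsupp.single_eq_same, smul_eq_mul,
      mul_one, map_zero, Finsupp.zero_apply] at h2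
    exact thickUnif_pow_pred_ne_zero _ (D.mult_pos i) h2
  refine ⟨b x, (eq_of_length_eq ?_ ?_ ?_).symm, hz⟩
  · exact Submodule.span_le.2 (Set.singleton_subset_iff.2 (b x).2)
  · have h := le_length_span_singleton _ _ _ _ hz
    rwa [Nat.sub_add_cancel (D.mult_pos i), ← P.length_eq i] at h
  · exact ne_top_of_le_ne_top (ENat.natCast_ne_top _)
      (length_span_singleton_le _ _ (D.mult i) _ (by rw [thickUnif_pow, zero_smul]))

/-- Homomorphisms `E → E / L → L` vanishing to order `N_i(L)` at `t_i` preserve the parabolic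
structure. -/
theorem smul_uRes_mem {L : LineSubbundle E} (F : L.Frame) (i : Fin D.ν) (N : ℕ)
    (hN : P.toRefined.N L i ≤ N) {a b g : ThickRing (D.pt i) (D.mult i)}
    (hg : thickUnif (D.pt i) (D.mult i) ^ N ∣ g)
    (hx : a • F.uRes (D.pt i) (D.mult i) + b • F.vRes (D.pt i) (D.mult i) ∈ P.l i) :
    (b * g) • F.uRes (D.pt i) (D.mult i) ∈ P.l i := by
  obtain ⟨z, hz, hz0⟩ := P.exists_generator i
  obtain ⟨α, β, hαβ⟩ := F.exists_coords _ _ z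
  obtain ⟨o, ho, β', hβ', rfl⟩ := thick_factor _ _ β
  set ϖ := thickUnif (D.pt i) (D.mult i) with hϖ
  have hnpos : 0 < D.mult i := D.mult_pos i
  -- With z = αu + ϖ^o β'v and β' a unit, c·z lies in `L` only if ϖ^o c = 0.
  have hlen : P.toRefined.interLength L i (Fin.last _) ≤ o := by
    have h : Module.length (ThickRing (D.pt i) (D.mult i))
        (P.toRefined.l i (Fin.last _) ⊓ L.restr (D.pt i) (D.mult i) : Submodule _ _) ≤ o := by
      refine length_le_of_forall_exists_smul _ _ _ z o ?_
      rintro x ⟨hx, hxL⟩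
      rw [SetLike.mem_coe, P.toRefined_l_last, hz] at hx
      obtain ⟨c, rfl⟩ := Submodule.mem_span_singleton.1 hx
      obtain ⟨d, hd⟩ := (F.mem_restr_iff _ _ _).1 hxL
      refine ⟨c, rfl, ?_⟩
      rw [hαβ, smul_add, smul_smul, smul_smul] at hd
      have hd' : (c * α) • F.uRes (D.pt i) (D.mult i) + (c * (ϖ ^ o * β')) • F.vRes (D.pt i) (D.mult i) =
          d • F.uRes (D.pt i) (D.mult i) + (0 : ThickRing (D.pt i) (D.mult i)) • F.vRes (D.pt i) (D.mult i) := by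
        rw [hd, zero_smul, add_zero]
      have h0 := (F.coords_res_eq _ _ hd').2
      rw [← mul_assoc] at h0
      rw [mul_comm]
      exact (IsUnit.mul_left_eq_zero hβ').1 h0
    rw [← P.toRefined.coe_interLength] at h
    exact_mod_cast h
  -- The full partial sum is n − 2·length(l ∩ L), which is at least n − 2o and at most `N`.
  have hNo : D.mult i ≤ N + 2 * o := by
    have h1 := P.toRefined.sum_eps_le_N L i ⟨D.mult i - 1, by omega⟩
    rw [P.toRefined.sum_eps] at h1
    have h2 : (Fin.succ ⟨D.mult i - 1, by omega⟩ : Fin (D.mult i + 1)) = Fin.last _ := by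
      apply Fin.ext
      simp only [Fin.val_succ, Fin.val_last]
      omega
    rw [h2] at h1
    simp only at h1
    omega
  obtain ⟨g', rfl⟩ := hg
  rw [hz] at hx
  obtain ⟨c, hc⟩ := Submodule.mem_span_singleton.1 hx
  rw [hαβ, smul_add, smul_smul, smul_smul] at hc
  have hb := (F.coords_res_eq _ _ hc).2
  rcases Nat.eq_zero_or_pos o with rfl | hopos
  · have h0 : ϖ ^ N = 0 := by
      rw [← Nat.sub_add_cancel (show D.mult i ≤ N by omega), pow_add, hϖ, thickUnif_pow, mul_zero]
    rw [h0, zero_mul, mul_zero, zero_smul]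
    exact zero_mem _
  · obtain ⟨m, -, α', hα', rfl⟩ := thick_factor _ _ α
    -- For o > 0 the `u`-coefficient of `z` is a unit: otherwise ϖ^{n−1} would kill `z`.
    have hm : m = 0 := by
      by_contra hm
      apply hz0
      have hpow : ∀ r, 0 < r → ϖ ^ (D.mult i - 1) * ϖ ^ r = 0 := by
        intro r hr
        rw [← pow_add, show D.mult i - 1 + r = D.mult i + (r - 1) by omega, pow_add, hϖ, thickUnif_pow, zero_mul]
      rw [hαβ, smul_add, smul_smul, smul_smul, ← mul_assoc, ← mul_assoc,
        hpow m (Nat.pos_of_ne_zero hm), hpow o hopos, zero_mul, zero_mul, zero_smul, zero_smul,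
        add_zero]
    subst hm
    obtain ⟨γ, hγ⟩ := hα'.exists_left_inv
    -- Multiplying `z` by ϖ^{n−o} removes its `v`-part, so ϖ^{n−o}u lies in l_i.
    have hu : ϖ ^ (D.mult i - o) • F.uRes (D.pt i) (D.mult i) = (γ * ϖ ^ (D.mult i - o)) • z := by
      have h1 : ϖ ^ (D.mult i - o) * ϖ ^ o = 0 := by
        rw [← pow_add, Nat.sub_add_cancel ho, hϖ, thickUnif_pow]
      have h2 : γ * ϖ ^ (D.mult i - o) * (ϖ ^ 0 * α') = ϖ ^ (D.mult i - o) := by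
        rw [pow_zero, one_mul]
        linear_combination ϖ ^ (D.mult i - o) * hγ
      have h3 : γ * ϖ ^ (D.mult i - o) * (ϖ ^ o * β') = 0 := by
        linear_combination γ * β' * h1
      rw [hαβ, smul_add, smul_smul, smul_smul, ← hϖ, h2, h3, zero_smul, add_zero]
    -- Here `b` is divisible by ϖ^o, so the product is divisible by ϖ^{o+N}, and o + N ≥ n − o.
    have hbg : b * (ϖ ^ N * g') = (c * β' * ϖ ^ (o + N - (D.mult i - o)) * g') * ϖ ^ (D.mult i - o) := by
      have h1 : ϖ ^ o * ϖ ^ N = ϖ ^ (o + N - (D.mult i - o)) * ϖ ^ (D.mult i - o) := by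
        rw [← pow_add, ← pow_add]
        congr 1
        omega
      rw [← hb]
      linear_combination (c * β' * g') * h1
    rw [hbg, mul_smul, hu, smul_smul, hz]
    exact Submodule.smul_mem _ _ (Submodule.mem_span_singleton_self z)

/-- A simple parabolic bundle is tame. -/
theorem Simple.tame (h : P.Simple) : P.toRefined.Tame := by
  intro L hdeg
  by_contra hcon
  have hle : ∑ i ∈ P.toRefined.Iplus L, P.toRefined.N L i ≤ 2 * L.degree - E.degree := by
    rcases not_and_or.1 hcon with h1 | h1
    · rw [Finset.not_nonempty_iff_eq_empty.1 h1, Finset.sum_empty]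
      omega
    · omega
  -- The degree of Hom(E/L, L); failure of tameness leaves room there for a section with the
  -- prescribed zeros.
  obtain ⟨m, hm⟩ := Int.eq_ofNat_of_zero_le (show 0 ≤ 2 * L.degree - E.degree by omega)
  -- Truncation at zero: points outside I⁺_L impose no vanishing.
  have hsum : ∑ i, (P.toRefined.N L i).toNat ≤ m := by
    have h1 : ((∑ i, (P.toRefined.N L i).toNat : ℕ) : ℤ) =
        ∑ i ∈ P.toRefined.Iplus L, P.toRefined.N L i := by
      rw [RefinedParabolic.Iplus, Finset.sum_filter]
      push_cast
      refine Finset.sum_congr rfl fun i _ => ?_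
      split_ifs with h0
      · exact Int.toNat_of_nonneg h0.le
      · rw [Int.toNat_of_nonpos (not_lt.1 h0), Nat.cast_zero]
    omega
  obtain ⟨g, hg0, hg, hdvd⟩ := exists_section D _ hsum
  obtain ⟨F⟩ := L.nonempty_frame
  -- The composite E → E/L → L → E given by the section `g`; it is nonzero and kills `L`, so it is
  -- not scalar.
  let φ : V →ₗ[K] V := (F.basis 0).constr K ![0, g 0 • F.u 0]
  have hφu0 : φ (F.u 0) = 0 := by
    rw [← F.basis_zero, Basis.constr_basis]
    rfl
  have hφv0 : φ (F.v 0) = g 0 • F.u 0 := by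
    rw [← F.basis_one, Basis.constr_basis]
    rfl
  have hφ : ∀ j, φ (F.u j) = 0 ∧ φ (F.v j) = g j • F.u j := by
    intro j
    fin_cases j
    · exact ⟨hφu0, hφv0⟩
    · refine ⟨?_, ?_⟩
      · change φ (F.u 1) = 0
        rw [F.u_one, map_smul, hφu0, smul_zero]
      · change φ (F.v 1) = g 1 • F.u 1
        rw [F.v_one, map_add, map_smul, map_smul, hφu0, hφv0, smul_zero, zero_add, F.u_one,
          ChartRing.smul_def, ChartRing.smul_def, smul_smul, smul_smul, hg, mul_right_comm,
          ← zpow_add₀ ratX_ne_zero]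
        congr 3
        change 2 * L.degree - E.degree = (m : ℤ) at hm
        omega
  have hval : ∀ j (a b : ChartRing j), φ (a • F.u j + b • F.v j) = (b * g j) • F.u j := by
    intro j a b
    rw [ChartRing.smul_def, ChartRing.smul_def, map_add, map_smul, map_smul, (hφ j).1, (hφ j).2,
      smul_zero, zero_add, mul_smul]
    rfl
  have hE : ∀ j, ∀ s ∈ E.sec j, φ s ∈ E.sec j := by
    intro j s hs
    obtain ⟨a, b, rfl⟩ := (F.mem_sec j s).1 hs
    rw [hval]
    exact (E.sec j).smul_mem _ (F.u_mem j)
  have hendo : P.IsEndo φ := by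
    refine ⟨hE, fun i s hs => ?_⟩
    obtain ⟨a, b, hab⟩ := (F.mem_sec _ s).1 s.2
    have h1 : (⟨φ s, hE _ s s.2⟩ : E.sec (chartIdx (D.pt i))) =
        (b * g (chartIdx (D.pt i))) • ⟨F.u _, F.u_mem _⟩ :=
      Subtype.ext ((congrArg φ hab).trans (hval _ a b))
    rw [h1, E.res_smul, map_mul]
    rw [F.res_eq _ _ s hab] at hs
    refine smul_uRes_mem F i _ (Int.self_le_toNat _) ?_ hs
    rw [thickUnif, ← map_pow]
    exact map_dvd _ (hdvd i)
  obtain ⟨c, hc⟩ := h φ hendo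
  have h1 := hc (F.u 0)
  have h2 := hc (F.v 0)
  rw [hφu0] at h1
  rw [(smul_eq_zero.1 h1.symm).resolve_right (F.u_ne_zero 0), zero_smul, hφv0,
    ChartRing.smul_def] at h2
  exact (smul_eq_zero.1 h2).elim (toK_ne_zero hg0) (F.u_ne_zero 0)

end Parabolic

end P1

theorem theoremA {V : Type*} [AddCommGroup V] [Module P1.K V] (D : P1.EffDivisor)
    (E : P1.RankTwoBundle V) :
    (∀ P : P1.RefinedParabolic D E,
      (P.Undecomposable ∧ P.Tame) ↔ ∃ w : P1.Weights D, P.Stable w) ∧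
    (∀ P : P1.Parabolic D E,
      (P.Simple ↔ ∃ w : P1.Weights D, P.toRefined.Stable w) ∧
      (P.Simple ↔ P.toRefined.Undecomposable ∧ P.toRefined.Tame)) := by
  refine ⟨fun P => P.undecomposable_and_tame_iff, fun P => ?_⟩
  have h : P.Simple ↔ P.toRefined.Undecomposable ∧ P.toRefined.Tame := by
    refine ⟨fun h => ⟨h.undecomposable, h.tame⟩, fun h => ?_⟩
    obtain ⟨w, hw⟩ := P.toRefined.undecomposable_and_tame_iff.1 h
    exact P1.Parabolic.simple_of_stable hw
  exact ⟨h.trans P.toRefined.undecomposable_and_tame_iff, h⟩
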